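/- Let $d \geq 1$ and $n \geq 1$ be integers. For a partition $\lambda = (1^{m_1} 2^{m_2} 3^{m_3} \cdots)$ of $n$, let $\boxplus^d(\lambda) = (d^{\,d m_1} (2d)^{d m_2} (3d)^{d m_3} \cdots)$, a partition of $d^2 n$ (each box of the Young diagram of $\lambda$ is subdivided into a $d \times d$ grid). For a partition $\mu = (\mu_1, \mu_2, \dots)$ and an integer $c \geq 1$, let $c \cdot \mu = (c\mu_1, c\mu_2, \dots)$. For partitions $\alpha, \beta$ of the same integer $N$, let $\chi^{\alpha}_{\beta}$ be the value of the irreducible complex character $\chi^{\alpha}$ of the symmetric group $S_N$ on permutations of cycle type $\beta$. (1) For all partitions $\lambda \vdash n$ and $\mu \vdash dn$, the character value $\chi^{\boxplus^d(\lambda)}_{d \cdot \mu}$ is an integer divisible by $d!$. (2) If $d \nmid n$, then $\chi^{\boxplus^d(\lambda)}_{d^2 \cdot \nu} = 0$ for all partitions $\lambda, \nu \vdash n$. -/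

import Mathlib

namespace Nat.Partition

open Equiv

/-- The partition `d · μ = (d μ₁, d μ₂, …)` obtained by multiplying every part by `d ≥ 1`. -/
def dilate {n : ℕ} (d : ℕ) (hd : 0 < d) (μ : n.Partition) : (d * n).Partition where
  parts := μ.parts.map (fun i => d * i)
  parts_pos := by
    intro i hi
    obtain ⟨j, hj, rfl⟩ := Multiset.mem_map.1 hi
    exact Nat.mul_pos hd (μ.parts_pos hj)
  parts_sum := by
    rw [Multiset.sum_map_mul_left, Multiset.map_id', μ.parts_sum]

/-- The partition `⊞ᵈ(λ)`: every part `i` of `λ` is replaced by `d` copies of `d * i`, so that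
`(1 ^ m₁ 2 ^ m₂ …)` becomes `(d ^ (d m₁) (2d) ^ (d m₂) …)`. -/
def boxPlus {n : ℕ} (d : ℕ) (hd : 0 < d) (lam : n.Partition) : (d ^ 2 * n).Partition where
  parts := lam.parts.bind (fun i => Multiset.replicate d (d * i))
  parts_pos := by
    intro i hi
    obtain ⟨j, hj, hi⟩ := Multiset.mem_bind.1 hi
    rw [Multiset.eq_of_mem_replicate hi]
    exact Nat.mul_pos hd (lam.parts_pos hj)
  parts_sum := by
    rw [Multiset.sum_bind]
    simp only [Multiset.sum_replicate, smul_eq_mul, ← mul_assoc]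
    rw [Multiset.sum_map_mul_left, Multiset.map_id', lam.parts_sum, pow_two]

/-- The Young diagram whose row lengths are the parts in weakly decreasing order. -/
def youngDiagram {n : ℕ} (lam : n.Partition) : YoungDiagram :=
  YoungDiagram.ofRowLens (lam.parts.sort (· ≥ ·)) (lam.parts.pairwise_sort (· ≥ ·)).sortedGE

theorem card_cellsOfRowLens (w : List ℕ) : (YoungDiagram.cellsOfRowLens w).card = w.sum := by
  induction w with
  | nil => rfl
  | cons a w ih =>
    rw [YoungDiagram.cellsOfRowLens, Finset.card_union_of_disjoint, Finset.card_map, ih]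
    · simp
    · rw [Finset.disjoint_left]
      rintro ⟨x, y⟩ h1 h2
      simp only [Finset.mem_product, Finset.mem_singleton] at h1
      obtain ⟨z, -, hz⟩ := Finset.mem_map.1 h2
      have := congrArg Prod.fst hz
      simp [h1.1] at this

theorem card_youngDiagram {n : ℕ} (lam : n.Partition) : lam.youngDiagram.cells.card = n := by
  have h : (lam.parts.sort (· ≥ ·)).sum = n := by
    rw [← Multiset.sum_coe, Multiset.sort_eq, lam.parts_sum]
  exact (card_cellsOfRowLens _).trans h

/-- A fixed (arbitrarily chosen) Young tableau of shape `λ ⊢ n`: a bijection from the `n` letters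
onto the cells of the diagram. A cell is a pair (row, column). -/
noncomputable def tableau {n : ℕ} (lam : n.Partition) : Fin n ≃ lam.youngDiagram.cells :=
  (Finset.equivFinOfCardEq lam.card_youngDiagram).symm

/-- `a_λ`: the sum of all permutations that preserve every row of the tableau. -/
noncomputable def rowSymmetrizer {n : ℕ} (lam : n.Partition) : MonoidAlgebra ℂ (Perm (Fin n)) :=
  ∑ σ : Perm (Fin n) with ∀ i, (lam.tableau (σ i)).1.1 = (lam.tableau i).1.1,
    MonoidAlgebra.single σ 1

/-- `b_λ`: the signed sum of all permutations that preserve every column of the tableau. -/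
noncomputable def columnAntisymmetrizer {n : ℕ} (lam : n.Partition) :
    MonoidAlgebra ℂ (Perm (Fin n)) :=
  ∑ σ : Perm (Fin n) with ∀ i, (lam.tableau (σ i)).1.2 = (lam.tableau i).1.2,
    MonoidAlgebra.single σ ((Perm.sign σ : ℤ) : ℂ)

/-- The irreducible `Sₙ`-module `V^λ`, as the left ideal `ℂ[Sₙ] · a_λ b_λ` generated by the
Young symmetrizer (the Specht module). -/
noncomputable def spechtModule {n : ℕ} (lam : n.Partition) :
    Ideal (MonoidAlgebra ℂ (Perm (Fin n))) :=
  Ideal.span {lam.rowSymmetrizer * lam.columnAntisymmetrizer}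

/-- The representation of `Sₙ` on `V^λ` by left multiplication. -/
noncomputable def spechtRepresentation {n : ℕ} (lam : n.Partition) :
    Representation ℂ (Perm (Fin n)) lam.spechtModule :=
  Representation.ofModule' lam.spechtModule

/-- The irreducible character `χ^λ : Sₙ → ℂ`, the trace of the action on `V^λ`. -/
noncomputable def irreducibleCharacter {n : ℕ} (lam : n.Partition) (w : Perm (Fin n)) : ℂ :=
  LinearMap.trace ℂ lam.spechtModule (lam.spechtRepresentation w)

end Nat.Partition

open Finset

namespace MonoidAlgebra

variable {G : Type*} [Group G] [Fintype G]

theorem coeff_mul_eq_sum (x y : MonoidAlgebra ℂ G) (g : G) :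
    (x * y).coeff g = ∑ h, x.coeff h * y.coeff (h⁻¹ * g) := by
  classical
  conv_lhs => rw [← sum_coeff_single x]
  rw [Finsupp.sum_fintype _ _ (by simp), Finset.sum_mul]
  simp

theorem eq_sum_single (x : MonoidAlgebra ℂ G) : x = ∑ g, x.coeff g • single g (1 : ℂ) := by
  classical
  conv_lhs => rw [← sum_coeff_single x]
  rw [Finsupp.sum_fintype _ _ (by simp)]
  simp

omit [Fintype G] in
theorem eq_zero_of_eq_neg {x : MonoidAlgebra ℂ G} (h : x = -x) : x = 0 := by
  ext g
  have := congrArg (fun y : MonoidAlgebra ℂ G => y.coeff g) h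
  simpa [self_eq_neg] using this

theorem coeff_one_mul_comm (x y : MonoidAlgebra ℂ G) :
    (x * y).coeff 1 = (y * x).coeff 1 := by
  rw [coeff_mul_eq_sum, coeff_mul_eq_sum, ← Equiv.sum_comp (Equiv.inv G)]
  refine Finset.sum_congr rfl fun g _ => ?_
  simp [mul_comm]

theorem trace_sandwich (w : G) (c : MonoidAlgebra ℂ G) :
    LinearMap.trace ℂ (MonoidAlgebra ℂ G)
      (LinearMap.mulLeft ℂ (single w (1 : ℂ)) ∘ₗ LinearMap.mulRight ℂ c) =
      ∑ g, c.coeff (g⁻¹ * w⁻¹ * g) := by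
  classical
  rw [LinearMap.trace_eq_matrix_trace ℂ (MonoidAlgebra.basis G ℂ), Matrix.trace]
  refine Finset.sum_congr rfl fun g _ => ?_
  rw [Matrix.diag_apply, LinearMap.toMatrix_apply, basis_apply]
  change (single w (1 : ℂ) * (single g 1 * c)).coeff g = _
  simp [mul_assoc]

theorem coeff_one_eq_zero_of_mul_self_eq_zero {c : MonoidAlgebra ℂ G} (hc : c * c = 0) :
    c.coeff 1 = 0 := by
  have h := trace_sandwich 1 c
  have hn : IsNilpotent (LinearMap.mulLeft ℂ (single (1 : G) (1 : ℂ)) ∘ₗ LinearMap.mulRight ℂ c) := by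
    refine ⟨2, LinearMap.ext fun x => ?_⟩
    rw [pow_two]
    change single (1 : G) (1 : ℂ) * (single (1 : G) (1 : ℂ) * (x * c) * c) = 0
    rw [mul_assoc (single (1 : G) (1 : ℂ)), mul_assoc x, hc]
    simp
  rw [(LinearMap.isNilpotent_trace_of_isNilpotent hn).eq_zero] at h
  simpa using h.symm

theorem trace_ofModule'_span_singleton {c : MonoidAlgebra ℂ G} {κ : ℂ} (hκ : κ ≠ 0)
    (hc : c * c = κ • c) (w : G) :
    LinearMap.trace ℂ (Ideal.span {c} : Ideal (MonoidAlgebra ℂ G))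
      (Representation.ofModule' (Ideal.span {c} : Ideal (MonoidAlgebra ℂ G)) w) =
      κ⁻¹ * ∑ g, c.coeff (g⁻¹ * w⁻¹ * g) := by
  let I : Ideal (MonoidAlgebra ℂ G) := Ideal.span {c}
  let i : I →ₗ[ℂ] MonoidAlgebra ℂ G := I.subtype.restrictScalars ℂ
  let p : MonoidAlgebra ℂ G →ₗ[ℂ] I :=
    κ⁻¹ • (LinearMap.codRestrict (I.restrictScalars ℂ) (LinearMap.mulRight ℂ c)
      (fun x => Ideal.mul_mem_left _ x (Ideal.mem_span_singleton_self c)) :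
        MonoidAlgebra ℂ G →ₗ[ℂ] I)
  have hp : ∀ x, ((p x : I) : MonoidAlgebra ℂ G) = κ⁻¹ • (x * c) := fun x => rfl
  have hpi : p ∘ₗ i = LinearMap.id := by
    refine LinearMap.ext fun x => Subtype.ext ?_
    obtain ⟨y, hy⟩ := Ideal.mem_span_singleton'.1 x.2
    change ((p (x : MonoidAlgebra ℂ G) : I) : MonoidAlgebra ℂ G) = x
    rw [hp, ← hy, mul_assoc, hc, mul_smul_comm, smul_smul, inv_mul_cancel₀ hκ, one_smul]
  have hfin : Module.Finite ℂ (MonoidAlgebra ℂ G) := Module.Finite.of_basis (MonoidAlgebra.basis G ℂ)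
  have : Module.Finite ℂ I := Module.Finite.of_surjective p fun x => ⟨i x, LinearMap.congr_fun hpi x⟩
  have hρ : Representation.ofModule' I w = (Representation.ofModule' I w ∘ₗ p) ∘ₗ i := by
    rw [LinearMap.comp_assoc, hpi, LinearMap.comp_id]
  change LinearMap.trace ℂ I (Representation.ofModule' I w) = _
  rw [hρ, LinearMap.trace_comp_comm', ← trace_sandwich, ← smul_eq_mul, ← map_smul]
  congr 1
  refine LinearMap.ext fun x => ?_
  have : ∀ y : I, ((Representation.ofModule' (k := ℂ) I w y : I) : MonoidAlgebra ℂ G) =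
      single w 1 * (y : MonoidAlgebra ℂ G) := by
    intro y
    simp [Representation.ofModule']
  change ((Representation.ofModule' (k := ℂ) I w (p x) : I) : MonoidAlgebra ℂ G) = κ⁻¹ • (single w 1 * (x * c))
  rw [this, hp, mul_smul_comm]

end MonoidAlgebra

open Equiv MonoidAlgebra

namespace Nat.Partition

variable {n : ℕ}

/-- The row index of the cell of the tableau of `lam` that contains the letter `i`. -/
noncomputable def row (lam : n.Partition) (i : Fin n) : ℕ := (lam.tableau i).1.1

/-- The column index of the cell of the tableau of `lam` that contains the letter `i`. -/
noncomputable def col (lam : n.Partition) (i : Fin n) : ℕ := (lam.tableau i).1.2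

theorem mem_youngDiagram_row_col (lam : n.Partition) (i : Fin n) :
    (lam.row i, lam.col i) ∈ lam.youngDiagram :=
  (lam.tableau i).2

theorem eq_of_row_eq_of_col_eq (lam : n.Partition) {i j : Fin n} (hr : lam.row i = lam.row j)
    (hc : lam.col i = lam.col j) : i = j :=
  lam.tableau.injective (Subtype.ext (Prod.ext hr hc))

theorem exists_row_eq_col_eq (lam : n.Partition) {p q : ℕ} (h : (p, q) ∈ lam.youngDiagram) :
    ∃ i, lam.row i = p ∧ lam.col i = q := by
  refine ⟨lam.tableau.symm ⟨(p, q), h⟩, ?_, ?_⟩ <;> simp [row, col]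

theorem card_col_eq_row_lt (lam : n.Partition) (j K : ℕ) :
    #{i | lam.col i = j ∧ lam.row i < K} = min (lam.youngDiagram.colLen j) K := by
  rw [← card_range (min _ _)]
  refine card_bij (fun i _ => lam.row i) ?_ ?_ ?_
  · intro i hi
    simp only [mem_filter_univ] at hi
    have := lam.mem_youngDiagram_row_col i
    rw [hi.1, YoungDiagram.mem_iff_lt_colLen] at this
    simp [this, hi.2]
  · intro i hi i' hi' h
    simp only [mem_filter_univ] at hi hi'
    exact lam.eq_of_row_eq_of_col_eq h (hi.1.trans hi'.1.symm)
  · intro r hr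
    rw [mem_range, lt_min_iff] at hr
    obtain ⟨i, rfl, rfl⟩ := lam.exists_row_eq_col_eq (YoungDiagram.mem_iff_lt_colLen.2 hr.1)
    exact ⟨i, by simp [hr.2], rfl⟩

theorem card_filter_eq_sum_col (lam : n.Partition) (p : Fin n → Prop) [DecidablePred p] :
    #{i | p i} = ∑ j ∈ univ.image lam.col, #{i | lam.col i = j ∧ p i} := by
  rw [card_eq_sum_card_fiberwise (f := lam.col) (t := univ.image lam.col) (by
    intro i _; simp)]
  refine sum_congr rfl fun j _ => ?_
  rw [filter_filter]
  simp only [and_comm]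

/-- The colouring `f` has distinct colours in every column of the tableau of `lam`. -/
def ColumnInjective {X : Type*} (lam : n.Partition) (f : Fin n → X) : Prop :=
  ∀ i j, f i = f j → lam.col i = lam.col j → i = j

theorem ColumnInjective.card_col_eq_le {X : Type*} [DecidableEq X] {lam : n.Partition}
    {f : Fin n → X} (hf : lam.ColumnInjective f) (S : Finset X) (j : ℕ) :
    #{i | lam.col i = j ∧ f i ∈ S} ≤ #{i | lam.col i = j ∧ lam.row i < #S} := by
  rw [card_col_eq_row_lt, le_min_iff]
  constructor
  · rw [← (show #{i | lam.col i = j ∧ lam.row i < lam.youngDiagram.colLen j} =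
      lam.youngDiagram.colLen j by rw [card_col_eq_row_lt, min_self])]
    refine card_le_card fun i hi => ?_
    simp only [mem_filter_univ] at hi ⊢
    refine ⟨hi.1, ?_⟩
    rw [← YoungDiagram.mem_iff_lt_colLen, ← hi.1]
    exact lam.mem_youngDiagram_row_col i
  · refine card_le_card_of_injOn f ?_ ?_
    · intro i hi
      simp only [coe_filter, mem_univ, true_and, Set.mem_ofPred_eq] at hi
      exact hi.2
    · intro i hi i' hi' h
      simp only [coe_filter, mem_univ, true_and, Set.mem_ofPred_eq] at hi hi'
      exact hf _ _ h (hi.1.trans hi'.1.symm)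

theorem ColumnInjective.card_le {X : Type*} [DecidableEq X] {lam : n.Partition}
    {f : Fin n → X} (hf : lam.ColumnInjective f) (S : Finset X) :
    #{i | f i ∈ S} ≤ #{i | lam.row i < #S} := by
  rw [card_filter_eq_sum_col lam, card_filter_eq_sum_col lam]
  exact sum_le_sum fun j _ => hf.card_col_eq_le S j

theorem ColumnInjective.mem_youngDiagram {lam : n.Partition} {g : Perm (Fin n)}
    (hf : lam.ColumnInjective (lam.row ∘ g)) (i : Fin n) :
    (lam.row (g i), lam.col i) ∈ lam.youngDiagram := by
  have key (K j : ℕ) (hj : j ∈ univ.image lam.col) :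
      #{i | lam.col i = j ∧ lam.row (g i) < K} = min (lam.youngDiagram.colLen j) K := by
    rw [← card_col_eq_row_lt]
    have hle : ∀ j ∈ univ.image lam.col, #{i | lam.col i = j ∧ lam.row (g i) < K} ≤
        #{i | lam.col i = j ∧ lam.row i < K} := by
      intro j _
      simpa using hf.card_col_eq_le (range K) j
    refine (sum_eq_sum_iff_of_le hle).1 ?_ j hj
    rw [← card_filter_eq_sum_col lam, ← card_filter_eq_sum_col lam]
    exact card_equiv g (by simp)
  set j := lam.col i with hj
  set k := lam.row (g i) with hk
  have hjm : j ∈ univ.image lam.col := by simp [hj]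
  have h1 := key k j hjm
  have h2 := key (k + 1) j hjm
  have h3 : #{i | lam.col i = j ∧ lam.row (g i) < k} <
      #{i | lam.col i = j ∧ lam.row (g i) < k + 1} := by
    refine card_lt_card ((Finset.ssubset_iff_of_subset ?_).2 ⟨i, ?_, ?_⟩)
    · intro x hx
      simp only [mem_filter_univ] at hx ⊢
      exact ⟨hx.1, by omega⟩
    · simp [hj, hk]
    · simp [hk]
  rw [YoungDiagram.mem_iff_lt_colLen]
  omega

theorem ColumnInjective.exists_perm {lam : n.Partition} {g : Perm (Fin n)}
    (hf : lam.ColumnInjective (lam.row ∘ g)) :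
    ∃ r u : Perm (Fin n), (∀ i, lam.row (r i) = lam.row i) ∧ (∀ i, lam.col (u i) = lam.col i) ∧
      g = r * u := by
  choose u hr hc using fun i => lam.exists_row_eq_col_eq (hf.mem_youngDiagram i)
  have hu : Function.Injective u := by
    intro i j h
    refine hf i j ?_ ?_
    · rw [Function.comp, Function.comp, ← hr i, ← hr j, h]
    · rw [← hc i, ← hc j, h]
  let v : Perm (Fin n) := Equiv.ofBijective u (Finite.injective_iff_bijective.1 hu)
  refine ⟨g * v⁻¹, v, fun i => ?_, hc, by group⟩
  have := hr (v⁻¹ i)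
  rw [show u (v⁻¹ i) = i from v.apply_symm_apply i] at this
  rw [this]
  rfl

theorem apply_symm_eq_of_apply_eq {α X : Type*} {f : α → X} {t : Perm α} (ht : ∀ i, f (t i) = f i)
    (i : α) : f (t.symm i) = f i := by
  rw [← ht (t.symm i), t.apply_symm_apply]

theorem apply_swap_eq_of_apply_eq {α X : Type*} [DecidableEq α] {f : α → X} {i j : α}
    (h : f i = f j) (x : α) : f (swap i j x) = f x := by
  rw [swap_apply_def]; split_ifs <;> simp [*]

/-- The sum of the permutations that preserve the colouring `f`. -/
noncomputable def stabSum {X : Type*} [DecidableEq X] (f : Fin n → X) :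
    MonoidAlgebra ℂ (Perm (Fin n)) :=
  ∑ w : Perm (Fin n) with ∀ i, f (w i) = f i, single w 1

theorem rowSymmetrizer_eq_stabSum (lam : n.Partition) : lam.rowSymmetrizer = stabSum lam.row := rfl

section stabSum

variable {X : Type*} [DecidableEq X] (f : Fin n → X)

theorem coeff_stabSum (w : Perm (Fin n)) :
    (stabSum f).coeff w = if ∀ i, f (w i) = f i then 1 else 0 := by
  rw [stabSum, coeff_sum, Finsupp.finsetSum_apply, sum_filter]
  rw [sum_eq_single w (fun x _ hx => by split_ifs <;> simp [hx]) (by simp)]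
  split_ifs <;> simp

theorem stabSum_comp_symm (g : Perm (Fin n)) :
    stabSum (f ∘ ⇑g⁻¹) = single g 1 * stabSum f * single g⁻¹ 1 := by
  ext w
  simp only [coeff_stabSum, coeff_mul_single_apply, coeff_single_mul_apply, one_mul, mul_one,
    inv_inv]
  congr 1
  rw [eq_iff_iff, ← g.forall_congr_right]
  simp

variable {f}

theorem single_mul_stabSum {t : Perm (Fin n)} (ht : ∀ i, f (t i) = f i) :
    single t 1 * stabSum f = stabSum f := by
  ext w
  simp only [coeff_stabSum, coeff_single_mul_apply, one_mul]
  congr 1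
  simp [apply_symm_eq_of_apply_eq ht]

theorem stabSum_mul_single {t : Perm (Fin n)} (ht : ∀ i, f (t i) = f i) :
    stabSum f * single t 1 = stabSum f := by
  ext w
  simp only [coeff_stabSum, coeff_mul_single_apply, mul_one]
  congr 1
  rw [eq_iff_iff, ← t.forall_congr_right]
  simp [ht]

theorem stabSum_mul_self : stabSum f * stabSum f =
    (#{w : Perm (Fin n) | ∀ i, f (w i) = f i} : ℂ) • stabSum f := by
  conv_lhs => enter [1]; rw [stabSum]
  rw [sum_mul, sum_congr rfl fun w hw => single_mul_stabSum (mem_filter_univ w |>.1 hw)]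
  rw [sum_const, Nat.cast_smul_eq_nsmul]

end stabSum

section columnAntisymmetrizer

variable (lam : n.Partition)

theorem coeff_columnAntisymmetrizer (w : Perm (Fin n)) :
    lam.columnAntisymmetrizer.coeff w =
      if ∀ i, lam.col (w i) = lam.col i then ((Perm.sign w : ℤ) : ℂ) else 0 := by
  rw [columnAntisymmetrizer, coeff_sum, Finsupp.finsetSum_apply, sum_filter]
  rw [sum_eq_single w (fun x _ hx => by split_ifs <;> simp [hx]) (by simp)]
  change (if ∀ i, lam.col (w i) = lam.col i then (single w ((Perm.sign w : ℤ) : ℂ)).coeff w else 0) = _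
  split_ifs <;> simp

variable {lam} {t : Perm (Fin n)}

theorem single_mul_columnAntisymmetrizer (ht : ∀ i, lam.col (t i) = lam.col i) :
    single t 1 * lam.columnAntisymmetrizer =
      ((Perm.sign t : ℤ) : ℂ) • lam.columnAntisymmetrizer := by
  ext w
  simp [coeff_columnAntisymmetrizer, apply_symm_eq_of_apply_eq ht]

theorem columnAntisymmetrizer_mul_single (ht : ∀ i, lam.col (t i) = lam.col i) :
    lam.columnAntisymmetrizer * single t 1 =
      ((Perm.sign t : ℤ) : ℂ) • lam.columnAntisymmetrizer := by
  ext w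
  have h : (∀ i, lam.col (w (t.symm i)) = lam.col i) ↔ ∀ i, lam.col (w i) = lam.col i := by
    rw [← t.forall_congr_right]
    simp [ht]
  simp [coeff_columnAntisymmetrizer, h, mul_comm]

theorem columnAntisymmetrizer_mul_stabSum_eq_zero {X : Type*} [DecidableEq X] {f : Fin n → X}
    (hf : ¬ lam.ColumnInjective f) : lam.columnAntisymmetrizer * stabSum f = 0 := by
  simp only [ColumnInjective, not_forall] at hf
  obtain ⟨i, j, hij, hc, hne⟩ := hf
  have h1 := single_mul_stabSum (apply_swap_eq_of_apply_eq hij)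
  have h2 := columnAntisymmetrizer_mul_single (lam := lam) (t := swap i j) (apply_swap_eq_of_apply_eq hc)
  rw [Perm.sign_swap hne] at h2
  have : lam.columnAntisymmetrizer * stabSum f = - (lam.columnAntisymmetrizer * stabSum f) := by
    conv_lhs => rw [← h1, ← mul_assoc, h2]
    simp
  exact eq_zero_of_eq_neg this

theorem stabSum_mul_columnAntisymmetrizer_eq_zero {X : Type*} [DecidableEq X] {f : Fin n → X}
    (hf : ¬ lam.ColumnInjective f) : stabSum f * lam.columnAntisymmetrizer = 0 := by
  simp only [ColumnInjective, not_forall] at hf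
  obtain ⟨i, j, hij, hc, hne⟩ := hf
  have h1 := stabSum_mul_single (apply_swap_eq_of_apply_eq hij)
  have h2 := single_mul_columnAntisymmetrizer (lam := lam) (t := swap i j) (apply_swap_eq_of_apply_eq hc)
  rw [Perm.sign_swap hne] at h2
  have : stabSum f * lam.columnAntisymmetrizer = - (stabSum f * lam.columnAntisymmetrizer) := by
    conv_lhs => rw [← h1, mul_assoc, h2]
    simp
  exact eq_zero_of_eq_neg this

end columnAntisymmetrizer

variable (lam : n.Partition)

/-- The Young symmetrizer `a_λ b_λ`. -/
noncomputable def youngSymmetrizer : MonoidAlgebra ℂ (Perm (Fin n)) :=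
  lam.rowSymmetrizer * lam.columnAntisymmetrizer

theorem eq_one_of_row_of_col {lam : n.Partition} {w : Perm (Fin n)}
    (hr : ∀ i, lam.row (w i) = lam.row i) (hc : ∀ i, lam.col (w i) = lam.col i) : w = 1 :=
  Equiv.ext fun i => lam.eq_of_row_eq_of_col_eq (hr i) (hc i)

theorem coeff_youngSymmetrizer_one : lam.youngSymmetrizer.coeff 1 = 1 := by
  rw [youngSymmetrizer, coeff_mul_eq_sum, sum_eq_single 1]
  · simp [rowSymmetrizer_eq_stabSum, coeff_stabSum, coeff_columnAntisymmetrizer]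
  · intro w _ hw
    rw [rowSymmetrizer_eq_stabSum, coeff_stabSum, coeff_columnAntisymmetrizer]
    split_ifs with hr hc
    · refine absurd (eq_one_of_row_of_col hr fun i => ?_) hw
      have := hc (w i)
      simp only [mul_one, Perm.inv_def, symm_apply_apply] at this
      exact this.symm
    all_goals simp
  · simp

theorem columnAntisymmetrizer_mul_single_mul_rowSymmetrizer (g : Perm (Fin n)) :
    lam.columnAntisymmetrizer * single g 1 * lam.rowSymmetrizer =
      lam.youngSymmetrizer.coeff g⁻¹ • (lam.columnAntisymmetrizer * lam.rowSymmetrizer) := by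
  have key : ∃ x : ℂ, lam.columnAntisymmetrizer * single g 1 * lam.rowSymmetrizer =
      x • (lam.columnAntisymmetrizer * lam.rowSymmetrizer) := by
    by_cases hf : lam.ColumnInjective (lam.row ∘ ⇑g⁻¹)
    · obtain ⟨r, u, hr, hu, hg⟩ := hf.exists_perm
      have hg' : g = u⁻¹ * r⁻¹ := by rw [← mul_inv_rev, ← hg, inv_inv]
      have hr' : ∀ i, lam.row (r⁻¹ i) = lam.row i := fun i => by rw [← hr (r⁻¹ i)]; simp
      have hu' : ∀ i, lam.col (u⁻¹ i) = lam.col i := fun i => by rw [← hu (u⁻¹ i)]; simp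
      refine ⟨((Perm.sign u⁻¹ : ℤ) : ℂ), ?_⟩
      rw [hg', show (single (u⁻¹ * r⁻¹) (1 : ℂ)) = single u⁻¹ 1 * single r⁻¹ 1 by simp,
        ← mul_assoc, columnAntisymmetrizer_mul_single hu', mul_assoc, rowSymmetrizer_eq_stabSum,
        single_mul_stabSum hr', smul_mul_assoc]
    · refine ⟨0, ?_⟩
      have h := columnAntisymmetrizer_mul_stabSum_eq_zero hf
      rw [stabSum_comp_symm, ← mul_assoc, ← mul_assoc] at h
      have h2 := congrArg (· * single g (1 : ℂ)) h
      simpa [mul_assoc, single_mul_single, one_def.symm, rowSymmetrizer_eq_stabSum] using h2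
  obtain ⟨x, hx⟩ := key
  have h : (lam.columnAntisymmetrizer * single g 1 * lam.rowSymmetrizer).coeff 1 =
      (x • (lam.columnAntisymmetrizer * lam.rowSymmetrizer)).coeff 1 := by rw [hx]
  rw [coeff_one_mul_comm, ← mul_assoc] at h
  change (lam.youngSymmetrizer * single g 1).coeff 1 = _ at h
  rw [coeff_mul_single_apply, coeff_smul, Finsupp.smul_apply, coeff_one_mul_comm] at h
  change _ = x • lam.youngSymmetrizer.coeff 1 at h
  rw [coeff_youngSymmetrizer_one] at h
  rw [hx]
  congr 1
  simpa using h.symm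

theorem rowSymmetrizer_mul_mul_columnAntisymmetrizer (x : MonoidAlgebra ℂ (Perm (Fin n))) :
    ∃ y : ℂ, lam.rowSymmetrizer * x * lam.columnAntisymmetrizer = y • lam.youngSymmetrizer := by
  have key (g : Perm (Fin n)) : ∃ y : ℂ,
      lam.rowSymmetrizer * single g 1 * lam.columnAntisymmetrizer = y • lam.youngSymmetrizer := by
    by_cases hf : lam.ColumnInjective (lam.row ∘ g)
    · obtain ⟨r, u, hr, hu, hg⟩ := hf.exists_perm
      refine ⟨((Perm.sign u : ℤ) : ℂ), ?_⟩
      rw [hg, show (single (r * u) (1 : ℂ)) = single r 1 * single u 1 by simp,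
        ← mul_assoc, rowSymmetrizer_eq_stabSum, stabSum_mul_single hr, mul_assoc,
        single_mul_columnAntisymmetrizer hu, mul_smul_comm]
      rfl
    · refine ⟨0, ?_⟩
      have hf' : ¬ lam.ColumnInjective (lam.row ∘ ⇑(g⁻¹)⁻¹) := by rwa [inv_inv]
      have h := stabSum_mul_columnAntisymmetrizer_eq_zero hf'
      rw [stabSum_comp_symm] at h
      have h2 := congrArg (single g (1 : ℂ) * ·) h
      simpa [← mul_assoc, single_mul_single, one_def.symm, rowSymmetrizer_eq_stabSum] using h2
  choose y hy using key
  refine ⟨∑ g, x.coeff g * y g, ?_⟩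
  conv_lhs => rw [eq_sum_single x]
  rw [mul_sum, sum_mul, sum_smul]
  refine sum_congr rfl fun g _ => ?_
  rw [mul_smul_comm, smul_mul_assoc, hy, smul_smul]

/-- The scalar `κ` with `c_λ² = κ c_λ` for the Young symmetrizer `c_λ`. -/
noncomputable def youngScalar : ℂ := (lam.youngSymmetrizer * lam.youngSymmetrizer).coeff 1

theorem youngSymmetrizer_mul_self :
    lam.youngSymmetrizer * lam.youngSymmetrizer = lam.youngScalar • lam.youngSymmetrizer := by
  obtain ⟨y, hy⟩ := lam.rowSymmetrizer_mul_mul_columnAntisymmetrizer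
    (lam.columnAntisymmetrizer * lam.rowSymmetrizer)
  have h : lam.youngSymmetrizer * lam.youngSymmetrizer = y • lam.youngSymmetrizer := by
    rw [← hy, youngSymmetrizer]; simp only [mul_assoc]
  rw [youngScalar, h, coeff_smul, Finsupp.smul_apply, coeff_youngSymmetrizer_one, smul_eq_mul,
    mul_one]

theorem youngScalar_ne_zero : lam.youngScalar ≠ 0 := by
  intro h
  have h1 := lam.youngSymmetrizer_mul_self
  rw [h, zero_smul] at h1
  have h2 := coeff_one_eq_zero_of_mul_self_eq_zero h1
  rw [coeff_youngSymmetrizer_one] at h2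
  exact one_ne_zero h2

theorem youngSymmetrizer_mul_single_mul_self (g : Perm (Fin n)) :
    lam.youngSymmetrizer * single g 1 * lam.youngSymmetrizer =
      (lam.youngSymmetrizer.coeff g⁻¹ * lam.youngScalar) • lam.youngSymmetrizer := by
  have h : lam.youngSymmetrizer * single g 1 * lam.youngSymmetrizer = lam.rowSymmetrizer *
      (lam.columnAntisymmetrizer * single g 1 * lam.rowSymmetrizer) *
        lam.columnAntisymmetrizer := by
    rw [youngSymmetrizer]; simp only [mul_assoc]
  have h' : lam.rowSymmetrizer * (lam.columnAntisymmetrizer * lam.rowSymmetrizer) *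
      lam.columnAntisymmetrizer = lam.youngSymmetrizer * lam.youngSymmetrizer := by
    rw [youngSymmetrizer]; simp only [mul_assoc]
  rw [h, columnAntisymmetrizer_mul_single_mul_rowSymmetrizer, mul_smul_comm, smul_mul_assoc,
    mul_smul, ← youngSymmetrizer_mul_self, h']

theorem irreducibleCharacter_eq (w : Perm (Fin n)) :
    lam.irreducibleCharacter w =
      lam.youngScalar⁻¹ * ∑ g, lam.youngSymmetrizer.coeff (g⁻¹ * w⁻¹ * g) := by
  have h := trace_ofModule'_span_singleton (c := lam.rowSymmetrizer * lam.columnAntisymmetrizer)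
    lam.youngScalar_ne_zero lam.youngSymmetrizer_mul_self w
  rw [youngSymmetrizer]
  exact h

end Nat.Partition

namespace Nat.Partition

variable {n : ℕ}

/-! ### Dominance -/

/-- The dominance order: the first `K` rows of `lam` hold at most as many cells as those of `mu`. -/
def DominatedBy (lam mu : n.Partition) : Prop :=
  ∀ K, #{i | lam.row i < K} ≤ #{i | mu.row i < K}

theorem card_row_eq (lam : n.Partition) (r : ℕ) :
    #{i | lam.row i = r} = lam.youngDiagram.rowLen r := by
  rw [← card_range (lam.youngDiagram.rowLen r)]
  refine card_bij (fun i _ => lam.col i) ?_ ?_ ?_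
  · intro i hi
    simp only [mem_filter_univ] at hi
    have := lam.mem_youngDiagram_row_col i
    rw [hi, YoungDiagram.mem_iff_lt_rowLen] at this
    simpa using this
  · intro i hi i' hi' h
    simp only [mem_filter_univ] at hi hi'
    exact lam.eq_of_row_eq_of_col_eq (hi.trans hi'.symm) h
  · intro c hc
    rw [mem_range] at hc
    obtain ⟨i, hr, rfl⟩ := lam.exists_row_eq_col_eq (YoungDiagram.mem_iff_lt_rowLen.2 hc)
    exact ⟨i, by simp [hr], rfl⟩

theorem card_row_lt_succ (lam : n.Partition) (K : ℕ) :
    #{i | lam.row i < K + 1} = #{i | lam.row i < K} + lam.youngDiagram.rowLen K := by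
  rw [← card_row_eq, ← card_union_of_disjoint]
  · congr 1
    ext i
    simp only [mem_filter_univ, mem_union]
    omega
  · rw [disjoint_filter]
    intros
    omega

theorem rowLens_youngDiagram (lam : n.Partition) :
    lam.youngDiagram.rowLens = lam.parts.sort (· ≥ ·) :=
  YoungDiagram.rowLens_ofRowLens_eq_self fun _ hx =>
    lam.parts_pos ((Multiset.mem_sort _).1 hx)

theorem youngDiagram_injective : Function.Injective (youngDiagram (n := n)) := by
  intro lam mu h
  have := lam.rowLens_youngDiagram
  rw [h, rowLens_youngDiagram] at this
  refine Nat.Partition.ext ?_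
  rw [← Multiset.sort_eq lam.parts (· ≥ ·), ← this, Multiset.sort_eq]

theorem DominatedBy.antisymm {lam mu : n.Partition} (h : lam.DominatedBy mu)
    (h' : mu.DominatedBy lam) : lam = mu := by
  have hK K := le_antisymm (h K) (h' K)
  have hrow r : lam.youngDiagram.rowLen r = mu.youngDiagram.rowLen r := by
    have := hK (r + 1)
    rw [card_row_lt_succ, card_row_lt_succ, hK r] at this
    omega
  refine youngDiagram_injective (YoungDiagram.ext (Finset.ext fun ⟨r, c⟩ => ?_))
  rw [YoungDiagram.mem_cells, YoungDiagram.mem_cells, YoungDiagram.mem_iff_lt_rowLen,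
    YoungDiagram.mem_iff_lt_rowLen, hrow]

theorem DominatedBy.trans {lam mu nu : n.Partition} (h : lam.DominatedBy mu)
    (h' : mu.DominatedBy nu) : lam.DominatedBy nu :=
  fun K => (h K).trans (h' K)

theorem ColumnInjective.card_lt_le {lam : n.Partition} {f : Fin n → ℕ}
    (hf : lam.ColumnInjective f) (K : ℕ) : #{i | f i < K} ≤ #{i | lam.row i < K} := by
  simpa using hf.card_le (range K)

theorem dominatedBy_of_columnInjective {lam mu : n.Partition} {g : Perm (Fin n)}
    (hf : lam.ColumnInjective (mu.row ∘ g)) : mu.DominatedBy lam := by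
  intro K
  refine le_trans (le_of_eq ?_) (hf.card_lt_le K)
  exact (card_equiv g (by simp)).symm

/-! ### Irreducible characters as an orthonormal basis of the class functions -/

/-- A function on the symmetric group that is constant on conjugacy classes. -/
def IsClassFunction (f : Perm (Fin n) → ℂ) : Prop := ∀ u v, IsConj u v → f u = f v

theorem isConj_inv_conj (g v : Perm (Fin n)) : IsConj (g * v * g⁻¹)⁻¹ v := by
  rw [Perm.isConj_iff_cycleType_eq, Perm.cycleType_inv, Perm.cycleType_conj]

theorem isClassFunction_irreducibleCharacter (lam : n.Partition) :
    IsClassFunction lam.irreducibleCharacter := by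
  intro u v h
  obtain ⟨c, rfl⟩ := isConj_iff.1 h
  rw [irreducibleCharacter_eq, irreducibleCharacter_eq]
  congr 1
  rw [← Equiv.sum_comp (Equiv.mulLeft c⁻¹)]
  refine sum_congr rfl fun g _ => ?_
  simp [mul_assoc]

/-- The multiplicity of the irreducible character of `lam` in the class function `f`. -/
noncomputable def mult (lam : n.Partition) (f : Perm (Fin n) → ℂ) : ℂ :=
  lam.youngScalar⁻¹ * ∑ w, f w * lam.youngSymmetrizer.coeff w

theorem sum_mul_irreducibleCharacter (lam : n.Partition) {f : Perm (Fin n) → ℂ}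
    (hf : IsClassFunction f) :
    ∑ w, f w * lam.irreducibleCharacter w = (n.factorial : ℂ) * lam.mult f := by
  simp only [irreducibleCharacter_eq, mul_sum, mult]
  rw [sum_comm]
  have (g : Perm (Fin n)) : ∑ w, f w * (lam.youngScalar⁻¹ *
      lam.youngSymmetrizer.coeff (g⁻¹ * w⁻¹ * g)) =
      ∑ w, lam.youngScalar⁻¹ * (f w * lam.youngSymmetrizer.coeff w) := by
    rw [← Equiv.sum_comp ((MulAut.conj g).toEquiv.trans (Equiv.inv _))]
    refine sum_congr rfl fun w _ => ?_
    have h1 : ((MulAut.conj g).toEquiv.trans (Equiv.inv _)) w = (g * w * g⁻¹)⁻¹ := rfl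
    rw [h1, hf _ _ (isConj_inv_conj g w)]
    have h2 : g⁻¹ * ((g * w * g⁻¹)⁻¹)⁻¹ * g = w := by group
    rw [h2]
    ring
  rw [sum_congr rfl fun g _ => this g, sum_const, Finset.card_univ, Fintype.card_perm, Fintype.card_fin,
    nsmul_eq_mul, mul_sum]

theorem sum_irreducibleCharacter_mul_coeff (lam mu : n.Partition) :
    ∑ w, mu.irreducibleCharacter w * lam.youngSymmetrizer.coeff w =
      mu.youngScalar⁻¹ * ∑ g, (lam.youngSymmetrizer * single g 1 * mu.youngSymmetrizer *
        single g⁻¹ 1).coeff 1 := by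
  simp only [irreducibleCharacter_eq]
  have (g : Perm (Fin n)) : (lam.youngSymmetrizer * single g 1 * mu.youngSymmetrizer *
        single g⁻¹ 1).coeff 1 =
      ∑ w, lam.youngSymmetrizer.coeff w * mu.youngSymmetrizer.coeff (g⁻¹ * w⁻¹ * g) := by
    rw [mul_assoc, mul_assoc, coeff_mul_eq_sum]
    refine sum_congr rfl fun w _ => ?_
    rw [coeff_single_mul_apply, coeff_mul_single_apply]
    simp [mul_assoc]
  rw [sum_congr rfl fun g _ => this g, sum_comm, mul_sum]
  refine sum_congr rfl fun w _ => ?_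
  rw [mul_sum, mul_sum, sum_mul]
  refine sum_congr rfl fun g _ => ?_
  ring

theorem mult_irreducibleCharacter_self (lam : n.Partition) :
    lam.mult lam.irreducibleCharacter = 1 := by
  rw [mult, sum_irreducibleCharacter_mul_coeff]
  have (g : Perm (Fin n)) : (lam.youngSymmetrizer * single g 1 * lam.youngSymmetrizer *
        single g⁻¹ 1).coeff 1 =
      lam.youngScalar * (lam.youngSymmetrizer.coeff g * lam.youngSymmetrizer.coeff (g⁻¹ * 1)) := by
    rw [youngSymmetrizer_mul_single_mul_self, smul_mul_assoc, coeff_smul, Finsupp.smul_apply,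
      coeff_mul_single_apply, smul_eq_mul]
    simp only [inv_inv, one_mul, mul_one]
    ring
  rw [sum_congr rfl fun g _ => this g, ← mul_sum, ← coeff_mul_eq_sum, ← youngScalar]
  have := lam.youngScalar_ne_zero
  field_simp

theorem mult_irreducibleCharacter_eq_zero_of_not_dominatedBy {lam mu : n.Partition}
    (h : ¬ mu.DominatedBy lam) : lam.mult mu.irreducibleCharacter = 0 := by
  rw [mult, sum_irreducibleCharacter_mul_coeff]
  have (g : Perm (Fin n)) : (lam.youngSymmetrizer * single g 1 * mu.youngSymmetrizer *
        single g⁻¹ 1) = 0 := by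
    have hz := columnAntisymmetrizer_mul_stabSum_eq_zero (lam := lam) (f := mu.row ∘ ⇑g⁻¹)
      fun hf => h (dominatedBy_of_columnInjective hf)
    rw [stabSum_comp_symm] at hz
    have e : single g (1 : ℂ) * mu.youngSymmetrizer =
        single g 1 * stabSum mu.row * single g⁻¹ 1 * (single g 1 * mu.columnAntisymmetrizer) := by
      rw [youngSymmetrizer, rowSymmetrizer_eq_stabSum]
      simp only [← mul_assoc]
      rw [mul_assoc _ (single g⁻¹ (1 : ℂ)) (single g 1), single_mul_single]
      simp [one_def.symm]
    rw [mul_assoc lam.youngSymmetrizer, e, youngSymmetrizer, mul_assoc lam.rowSymmetrizer,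
      ← mul_assoc lam.columnAntisymmetrizer, hz]
    simp
  simp [this]

theorem mult_irreducibleCharacter_comm (lam mu : n.Partition) :
    lam.mult mu.irreducibleCharacter = mu.mult lam.irreducibleCharacter := by
  have h1 := sum_mul_irreducibleCharacter lam mu.isClassFunction_irreducibleCharacter
  have h2 := sum_mul_irreducibleCharacter mu lam.isClassFunction_irreducibleCharacter
  have hn : (n.factorial : ℂ) ≠ 0 := by exact_mod_cast n.factorial_ne_zero
  refine mul_left_cancel₀ hn ?_
  rw [← h1, ← h2]
  exact sum_congr rfl fun w _ => mul_comm _ _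

theorem mult_irreducibleCharacter_of_ne {lam mu : n.Partition} (h : lam ≠ mu) :
    lam.mult mu.irreducibleCharacter = 0 := by
  by_cases h1 : mu.DominatedBy lam
  · rw [mult_irreducibleCharacter_comm]
    exact mult_irreducibleCharacter_eq_zero_of_not_dominatedBy fun h2 => h (h2.antisymm h1)
  · exact mult_irreducibleCharacter_eq_zero_of_not_dominatedBy h1

theorem mult_sum_irreducibleCharacter (lam : n.Partition) (c : n.Partition → ℂ) :
    lam.mult (fun w => ∑ mu, c mu * mu.irreducibleCharacter w) = c lam := by
  have h : lam.mult (fun w => ∑ mu, c mu * mu.irreducibleCharacter w) =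
      ∑ mu, c mu * lam.mult mu.irreducibleCharacter := by
    simp only [mult, mul_sum, sum_mul]
    rw [sum_comm]
    refine sum_congr rfl fun mu _ => sum_congr rfl fun w _ => ?_
    ring
  rw [h, sum_eq_single lam, mult_irreducibleCharacter_self, mul_one]
  · intro mu _ hne
    rw [mult_irreducibleCharacter_of_ne hne.symm, mul_zero]
  · simp

theorem IsClassFunction.exists_eq_sum {f : Perm (Fin n) → ℂ} (hf : IsClassFunction f) :
    ∃ c : n.Partition → ℂ, ∀ w, f w = ∑ mu, c mu * mu.irreducibleCharacter w := by
  classical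
  let ext (f : Perm (Fin n) → ℂ) (ρ : (Fintype.card (Fin n)).Partition) : ℂ :=
    if h : ∃ w : Perm (Fin n), w.partition = ρ then f h.choose else 0
  have hext {f : Perm (Fin n) → ℂ} (hf : IsClassFunction f) (w : Perm (Fin n)) :
      ext f w.partition = f w := by
    have h : ∃ w' : Perm (Fin n), w'.partition = w.partition := ⟨w, rfl⟩
    simp only [ext, dif_pos h]
    exact hf _ _ (Perm.partition_eq_of_isConj.2 h.choose_spec)
  let X (mu : n.Partition) := ext mu.irreducibleCharacter
  have hX (c : n.Partition → ℂ) (w : Perm (Fin n)) : (∑ mu, c mu • X mu) w.partition =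
      ∑ mu, c mu * mu.irreducibleCharacter w := by
    rw [Finset.sum_apply]
    refine sum_congr rfl fun mu _ => ?_
    rw [Pi.smul_apply, smul_eq_mul]
    congr 1
    exact hext mu.isClassFunction_irreducibleCharacter w
  have hli : LinearIndependent ℂ X := by
    rw [Fintype.linearIndependent_iff]
    intro c hc lam
    rw [← mult_sum_irreducibleCharacter lam c]
    simp only [← hX, hc]
    simp [mult]
  have hcard : Fintype.card n.Partition =
      Module.finrank ℂ ((Fintype.card (Fin n)).Partition → ℂ) := by
    rw [Module.finrank_fintype_fun_eq_card, Fintype.card_fin]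
  have hspan := hli.span_eq_top_of_card_eq_finrank' hcard
  have hmem : ext f ∈ Submodule.span ℂ (Set.range X) := by rw [hspan]; trivial
  obtain ⟨c, hc⟩ := (Submodule.mem_span_range_iff_exists_fun ℂ).1 hmem
  refine ⟨c, fun w => ?_⟩
  rw [← hX, hc, hext hf]

theorem IsClassFunction.eq_sum_mult {f : Perm (Fin n) → ℂ} (hf : IsClassFunction f)
    (w : Perm (Fin n)) : f w = ∑ mu : n.Partition, mu.mult f * mu.irreducibleCharacter w := by
  obtain ⟨c, hc⟩ := hf.exists_eq_sum
  have : f = fun w => ∑ mu, c mu * mu.irreducibleCharacter w := funext hc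
  simp only [this, mult_sum_irreducibleCharacter]

theorem IsClassFunction.sum_mul {f h : Perm (Fin n) → ℂ} (hf : IsClassFunction f)
    (hh : IsClassFunction h) :
    ∑ w, f w * h w = (n.factorial : ℂ) * ∑ mu : n.Partition, mu.mult h * mu.mult f := by
  have : ∀ w, f w * h w = ∑ mu : n.Partition, mu.mult h * (f w * mu.irreducibleCharacter w) := by
    intro w
    rw [hh.eq_sum_mult w, mul_sum]
    exact sum_congr rfl fun mu _ => by ring
  rw [sum_congr rfl fun w _ => this w, sum_comm, mul_sum]
  refine sum_congr rfl fun mu _ => ?_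
  rw [← mul_sum, sum_mul_irreducibleCharacter mu hf]
  ring

end Nat.Partition

/-! ### Colourings of a finite set -/

namespace Coloring

variable {α ι κ : Type*} [Fintype α] [DecidableEq α] [DecidableEq ι] [DecidableEq κ]

/-- The number of letters of each colour. -/
def content (f : α → ι) (r : ι) : ℕ := #{i | f i = r}

/-- The number of permutations that preserve the colouring `f`. -/
def stabCard (f : α → ι) : ℕ := #{w : Perm α | ∀ i, f (w i) = f i}

omit [DecidableEq α] in
theorem content_comp_perm (f : α → ι) (g : Perm α) : content (f ∘ g) = content f := by
  funext r
  exact card_equiv g (by simp)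

omit [DecidableEq α] in
theorem exists_perm_of_content_eq {f f' : α → ι} (h : content f = content f') :
    ∃ g : Perm α, f' ∘ g = f := by
  have e (r : ι) : Nonempty ({i // f i = r} ≃ {i // f' i = r}) := by
    rw [← Fintype.card_eq, Fintype.card_subtype, Fintype.card_subtype]
    exact congrFun h r
  refine ⟨Equiv.ofFiberEquiv fun r => (e r).some, funext fun i => ?_⟩
  exact Equiv.ofFiberEquiv_map _ i

omit [DecidableEq α] in
theorem sum_content [Fintype ι] (f : α → ι) : ∑ r, content f r = Fintype.card α := by
  rw [← Finset.card_univ, card_eq_sum_card_fiberwise (f := f) (t := univ) (by simp)]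
  rfl

omit [DecidableEq α] in
theorem exists_content_eq [Fintype ι] {M : ι → ℕ} (hM : ∑ r, M r = Fintype.card α) :
    ∃ f : α → ι, content f = M := by
  have e : Nonempty (α ≃ Σ r, Fin (M r)) := by
    rw [← Fintype.card_eq]; simp [hM]
  obtain ⟨e⟩ := e
  refine ⟨fun i => (e i).1, funext fun r => ?_⟩
  rw [content, ← Fintype.card_subtype, ← Fintype.card_fin (M r)]
  refine Fintype.card_congr ((e.subtypeEquiv fun i => Iff.rfl).trans
    (Equiv.sigmaSubtype (β := fun r => Fin (M r)) r))

theorem stabCard_pos (f : α → ι) : 0 < stabCard f := by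
  rw [stabCard, card_pos]
  exact ⟨1, by simp⟩

theorem card_perm_comp_eq (f : α → ι) (g₀ : Perm α) :
    #{g : Perm α | f ∘ g = f ∘ g₀} = stabCard f := by
  refine card_equiv (Equiv.mulRight g₀⁻¹) fun g => ?_
  simp only [mem_filter_univ, Equiv.coe_mulRight, Perm.coe_mul, Function.comp_apply]
  rw [funext_iff, ← g₀⁻¹.forall_congr_right]
  simp

theorem stabCard_comp_perm (f : α → ι) (g : Perm α) : stabCard (f ∘ g) = stabCard f := by
  refine card_equiv (MulAut.conj g).toEquiv fun w => ?_
  simp only [mem_filter_univ, Function.comp_apply]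
  rw [← g⁻¹.forall_congr_right]
  simp [MulAut.conj_apply]

theorem sum_perm_comp [Fintype ι] (f : α → ι) (F : (α → ι) → ℂ) :
    ∑ g : Perm α, F (f ∘ g) =
      (stabCard f : ℂ) * ∑ f' : α → ι with content f' = content f, F f' := by
  rw [← sum_fiberwise_of_maps_to (s := univ) (t := {f' : α → ι | content f' = content f})
    (g := fun g : Perm α => f ∘ g) (fun g _ => by simp [content_comp_perm]), mul_sum]
  refine sum_congr rfl fun f' hf' => ?_
  obtain ⟨g₀, hg₀⟩ := exists_perm_of_content_eq (mem_filter_univ f' |>.1 hf')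
  refine (sum_congr (g := fun _ => F f') rfl fun g hg => ?_).trans ?_
  · exact congrArg F ((mem_filter_univ g).1 hg)
  rw [sum_const, nsmul_eq_mul, ← hg₀, card_perm_comp_eq]

theorem sum_stabCard [Fintype ι] {M : ι → ℕ} (hM : ∑ r, M r = Fintype.card α) :
    ∑ f : α → ι with content f = M, (stabCard f : ℂ) = (Fintype.card α).factorial := by
  obtain ⟨f, rfl⟩ := exists_content_eq hM
  have h := sum_perm_comp f fun f' => (stabCard f' : ℂ)
  have h0 : (stabCard f : ℂ) ≠ 0 := by exact_mod_cast (stabCard_pos f).ne'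
  refine mul_left_cancel₀ h0 ?_
  rw [← h, sum_congr rfl fun g _ => by rw [stabCard_comp_perm], sum_const, Finset.card_univ,
    Fintype.card_perm, nsmul_eq_mul, mul_comm]

/-- The sum of `Φ (content f)` over the colourings `f` that are constant on the cycles of `w`. For
`Φ` the indicator of a composition this is the permutation character of a Young subgroup. -/
noncomputable def colorSum [Fintype ι] (Φ : (ι → ℕ) → ℂ) (w : Perm α) : ℂ :=
  ∑ f : α → ι with ∀ i, f (w i) = f i, Φ (content f)

theorem colorSum_conj [Fintype ι] (Φ : (ι → ℕ) → ℂ) (w c : Perm α) :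
    colorSum Φ (c * w * c⁻¹) = colorSum Φ w := by
  refine sum_equiv (c⁻¹.arrowCongr (Equiv.refl ι)) (fun f => ?_) fun f _ => ?_
  · simp only [mem_filter_univ]
    rw [← c.forall_congr_right]
    simp [Perm.inv_def]
  · exact congrArg Φ (content_comp_perm f c).symm

omit [DecidableEq α] in
theorem content_fst [Fintype ι] [Fintype κ] (F : α → ι × κ) (r : ι) :
    content (Prod.fst ∘ F) r = ∑ s, content F (r, s) := by
  rw [content, card_eq_sum_card_fiberwise (f := Prod.snd ∘ F) (t := univ) (by simp)]
  refine sum_congr rfl fun s _ => ?_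
  rw [filter_filter]
  simp [content, Prod.ext_iff]

omit [DecidableEq α] in
theorem content_snd [Fintype ι] [Fintype κ] (F : α → ι × κ) (s : κ) :
    content (Prod.snd ∘ F) s = ∑ r, content F (r, s) := by
  rw [content, card_eq_sum_card_fiberwise (f := Prod.fst ∘ F) (t := univ) (by simp)]
  refine sum_congr rfl fun r _ => ?_
  rw [filter_filter]
  simp [content, Prod.ext_iff, and_comm]

theorem sum_colorSum_mul_colorSum [Fintype ι] [Fintype κ] (Φ : (ι → ℕ) → ℂ) (Ψ : (κ → ℕ) → ℂ) :
    ∑ w : Perm α, colorSum Φ w * colorSum Ψ w = ((Fintype.card α).factorial : ℂ) *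
      ∑ M ∈ piAntidiag (univ : Finset (ι × κ)) (Fintype.card α),
        Φ (fun r => ∑ s, M (r, s)) * Ψ (fun s => ∑ r, M (r, s)) := by
  have h1 (w : Perm α) : colorSum Φ w * colorSum Ψ w =
      ∑ F : α → ι × κ, if ∀ i, F (w i) = F i then
        Φ (content (Prod.fst ∘ F)) * Ψ (content (Prod.snd ∘ F)) else 0 := by
    rw [colorSum, colorSum, sum_mul_sum, ← sum_product', ← sum_filter]
    symm
    refine sum_equiv (Equiv.arrowProdEquivProdArrow α (fun _ => ι) (fun _ => κ)) (fun F => ?_)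
      fun F _ => rfl
    simp [Prod.ext_iff, forall_and]
  rw [sum_congr rfl fun w _ => h1 w, sum_comm]
  have h2 (F : α → ι × κ) : (∑ w : Perm α, if ∀ i, F (w i) = F i then
        Φ (content (Prod.fst ∘ F)) * Ψ (content (Prod.snd ∘ F)) else 0) =
      (stabCard F : ℂ) * (Φ (fun r => ∑ s, content F (r, s)) *
        Ψ (fun s => ∑ r, content F (r, s))) := by
    rw [← sum_filter, sum_const, nsmul_eq_mul, stabCard]
    congr 2
    · exact congrArg Φ (funext (content_fst F))
    · exact congrArg Ψ (funext (content_snd F))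
  rw [sum_congr rfl fun F _ => h2 F, mul_sum,
    ← sum_fiberwise_of_maps_to (g := content) (t := piAntidiag univ (Fintype.card α))
      (fun F _ => by simp [sum_content])]
  refine sum_congr rfl fun M hM => ?_
  rw [← sum_stabCard (mem_piAntidiag.1 hM).1, sum_mul]
  refine sum_congr rfl fun F hF => ?_
  rw [(mem_filter_univ F).1 hF]

end Coloring

namespace Nat.Partition

open Coloring

variable {n : ℕ} {ι : Type*} [Fintype ι] [DecidableEq ι]

theorem isClassFunction_colorSum (Φ : (ι → ℕ) → ℂ) :
    IsClassFunction (n := n) (colorSum Φ) := by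
  intro u v h
  obtain ⟨c, rfl⟩ := isConj_iff.1 h
  exact (colorSum_conj Φ u c).symm

theorem sum_colorSum_mul_coeff (Φ : (ι → ℕ) → ℂ) (x : MonoidAlgebra ℂ (Perm (Fin n))) :
    ∑ w, colorSum Φ w * x.coeff w = ∑ f : Fin n → ι, Φ (content f) * (x * stabSum f).coeff 1 := by
  have h (f : Fin n → ι) : Φ (content f) * (x * stabSum f).coeff 1 =
      ∑ w, (if ∀ i, f (w i) = f i then Φ (content f) else 0) * x.coeff w := by
    rw [coeff_mul_eq_sum, mul_sum]
    refine sum_congr rfl fun w _ => ?_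
    have : (∀ i, f (w⁻¹ i) = f i) ↔ ∀ i, f (w i) = f i := by
      rw [← w.forall_congr_right]
      simp [eq_comm]
    rw [mul_one, coeff_stabSum]
    simp only [this]
    split_ifs <;> ring
  rw [sum_congr rfl fun f _ => h f, sum_comm]
  refine sum_congr rfl fun w _ => ?_
  rw [← sum_mul, colorSum, sum_filter]
  congr! 1
  congr!

omit [Fintype ι] in
theorem youngSymmetrizer_mul_stabSum_eq_zero {lam : n.Partition} {f : Fin n → ι}
    (hf : ¬ lam.ColumnInjective f) : lam.youngSymmetrizer * stabSum f = 0 := by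
  rw [youngSymmetrizer, mul_assoc, columnAntisymmetrizer_mul_stabSum_eq_zero hf, mul_zero]

theorem mult_colorSum_eq_zero {lam : n.Partition} {Φ : (ι → ℕ) → ℂ}
    (h : ∀ f : Fin n → ι, lam.ColumnInjective f → Φ (content f) = 0) :
    lam.mult (colorSum Φ) = 0 := by
  rw [mult, sum_colorSum_mul_coeff, sum_eq_zero, mul_zero]
  intro f _
  by_cases hf : lam.ColumnInjective f
  · rw [h f hf, zero_mul]
  · rw [youngSymmetrizer_mul_stabSum_eq_zero hf]
    simp

theorem sum_coeff_youngSymmetrizer_mul_stabSum (lam : n.Partition) :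
    ∑ g : Perm (Fin n), (lam.youngSymmetrizer * stabSum (lam.row ∘ g)).coeff 1 =
      stabCard lam.row * lam.youngScalar := by
  have h (g : Perm (Fin n)) : (lam.youngSymmetrizer * stabSum (lam.row ∘ g)).coeff 1 =
      lam.youngSymmetrizer.coeff g * (lam.rowSymmetrizer *
        (lam.columnAntisymmetrizer * lam.rowSymmetrizer)).coeff (g⁻¹ * 1) := by
    have e : stabSum (lam.row ∘ g) = single g⁻¹ 1 * lam.rowSymmetrizer * single g 1 := by
      have := stabSum_comp_symm lam.row g⁻¹
      rwa [inv_inv] at this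
    have e' : lam.youngSymmetrizer * stabSum (lam.row ∘ g) = lam.rowSymmetrizer *
        (lam.columnAntisymmetrizer * single g⁻¹ 1 * lam.rowSymmetrizer) * single g 1 := by
      rw [e, youngSymmetrizer]
      simp only [mul_assoc]
    rw [e', columnAntisymmetrizer_mul_single_mul_rowSymmetrizer, mul_smul_comm, smul_mul_assoc,
      coeff_smul, Finsupp.smul_apply, coeff_mul_single_apply, inv_inv, smul_eq_mul, mul_one, one_mul,
      mul_one]
  have hs : lam.rowSymmetrizer * lam.rowSymmetrizer =
      (stabCard lam.row : ℂ) • lam.rowSymmetrizer := by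
    rw [rowSymmetrizer_eq_stabSum, stabSum_mul_self, stabCard]
    congr!
  rw [sum_congr rfl fun g _ => h g, ← coeff_mul_eq_sum, coeff_one_mul_comm, youngSymmetrizer]
  have e : lam.rowSymmetrizer * (lam.columnAntisymmetrizer * lam.rowSymmetrizer) *
      (lam.rowSymmetrizer * lam.columnAntisymmetrizer) = lam.rowSymmetrizer *
      lam.columnAntisymmetrizer * (lam.rowSymmetrizer * lam.rowSymmetrizer) *
        lam.columnAntisymmetrizer := by
    simp only [mul_assoc]
  rw [e, hs, mul_smul_comm, smul_mul_assoc, coeff_smul, Finsupp.smul_apply, smul_eq_mul,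
    youngScalar, youngSymmetrizer]
  simp only [mul_assoc]

theorem stabSum_comp_of_injective {X Y : Type*} [DecidableEq X] [DecidableEq Y] {e : X → Y}
    (he : Function.Injective e) (f : Fin n → X) : stabSum (e ∘ f) = stabSum f := by
  simp [stabSum, he.eq_iff]

theorem mult_colorSum_eq {lam : n.Partition} {Φ : (ι → ℕ) → ℂ} {e : ι → ℕ}
    (he : Function.Injective e) {f₀ : Fin n → ι} (hf₀ : e ∘ f₀ = lam.row)
    (h : ∀ f : Fin n → ι, lam.ColumnInjective f → Φ (content f) ≠ 0 → content f = content f₀) :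
    lam.mult (colorSum Φ) = Φ (content f₀) := by
  have hsum : ∑ f : Fin n → ι, Φ (content f) * (lam.youngSymmetrizer * stabSum f).coeff 1 =
      ∑ f : Fin n → ι with content f = content f₀,
        Φ (content f₀) * (lam.youngSymmetrizer * stabSum f).coeff 1 := by
    rw [sum_filter]
    refine sum_congr rfl fun f _ => ?_
    split_ifs with hc
    · rw [hc]
    · by_cases hf : lam.ColumnInjective f
      · rw [not_ne_iff.1 (mt (h f hf) hc), zero_mul]
      · rw [youngSymmetrizer_mul_stabSum_eq_zero hf]
        simp
  have hstab (g : Perm (Fin n)) : stabSum (lam.row ∘ g) = stabSum (f₀ ∘ g) := by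
    rw [← hf₀, Function.comp_assoc, stabSum_comp_of_injective he]
  have hcard : stabCard f₀ = stabCard lam.row := by
    simp only [← hf₀, stabCard, Function.comp_apply, he.eq_iff]
    congr!
  have key := sum_perm_comp f₀ fun f => (lam.youngSymmetrizer * stabSum f).coeff 1
  have h0 : (stabCard f₀ : ℂ) ≠ 0 := by exact_mod_cast (stabCard_pos f₀).ne'
  simp only [← hstab] at key
  rw [sum_coeff_youngSymmetrizer_mul_stabSum, hcard] at key
  rw [hcard] at h0
  rw [mult, sum_colorSum_mul_coeff, hsum, ← mul_sum, ← mul_left_cancel₀ h0 key]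
  have := lam.youngScalar_ne_zero
  field_simp

end Nat.Partition

/-! ### Alternants -/

/-- The coefficient of `x ^ γ` in the alternant `a_δ = ∑ σ, sign σ * x ^ (δ ∘ σ)`. -/
def alternant {ι : Type*} [Fintype ι] [DecidableEq ι] (δ : ι → ℕ) (γ : ι → ℤ) : ℤ :=
  (Matrix.of fun r s => if γ r = δ s then (1 : ℤ) else 0).det

section alternant

variable {ι : Type*} [Fintype ι] [DecidableEq ι] {δ : ι → ℕ}

/-- Antisymmetry of a function of an exponent vector. -/
def IsAlternating (F : (ι → ℤ) → ℤ) : Prop :=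
  ∀ (π : Perm ι) (γ : ι → ℤ), F (γ ∘ π) = (Perm.sign π : ℤ) * F γ

theorem isAlternating_alternant (δ : ι → ℕ) : IsAlternating (alternant δ) := by
  intro π γ
  have h := Matrix.det_permute π (Matrix.of fun r s => if γ r = δ s then (1 : ℤ) else 0)
  rw [Int.cast_id] at h
  exact h

theorem alternant_self (hδ : Function.Injective δ) : alternant δ (fun r => δ r) = 1 := by
  rw [alternant, ← Matrix.det_one (n := ι)]
  congr 1
  ext r s
  simp [Matrix.one_apply, hδ.eq_iff]

theorem exists_perm_of_alternant_ne_zero {γ : ι → ℤ} (h : alternant δ γ ≠ 0) :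
    ∃ σ : Perm ι, ∀ r, γ r = δ (σ r) := by
  rw [alternant, Matrix.det_apply] at h
  obtain ⟨σ, -, hσ⟩ := exists_ne_zero_of_sum_ne_zero h
  refine ⟨σ⁻¹, fun r => ?_⟩
  have h1 : ∏ i, (Matrix.of fun r s => if γ r = δ s then (1 : ℤ) else 0) (σ i) i ≠ 0 := by
    intro h0
    rw [h0, smul_zero] at hσ
    exact hσ rfl
  have h2 := prod_ne_zero_iff.1 h1 (σ⁻¹ r) (mem_univ _)
  simp only [Matrix.of_apply, ne_eq, ite_eq_right_iff, one_ne_zero, imp_false, not_not] at h2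
  simpa using h2

/-- Multiplication by the complete homogeneous symmetric polynomial of degree `m`, on
coefficients. -/
def mulComplete (m : ℕ) (F : (ι → ℤ) → ℤ) (γ : ι → ℤ) : ℤ :=
  ∑ c ∈ piAntidiag (univ : Finset ι) m, F (fun r => γ r - c r)

theorem IsAlternating.mulComplete {F : (ι → ℤ) → ℤ} (hF : IsAlternating F) (m : ℕ) :
    IsAlternating (mulComplete m F) := by
  intro π γ
  rw [_root_.mulComplete, _root_.mulComplete, mul_sum]
  refine sum_equiv (π.arrowCongr (Equiv.refl ℕ)) (fun c => ?_) fun c _ => ?_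
  · simp only [mem_piAntidiag, mem_univ, implies_true, and_true]
    rw [← Equiv.sum_comp π ((π.arrowCongr (Equiv.refl ℕ)) c)]
    simp
  · rw [← hF]
    congr 1
    funext r
    simp

theorem IsAlternating.eq_zero_of_not_injective {F : (ι → ℤ) → ℤ} (hF : IsAlternating F)
    {γ : ι → ℤ} (hγ : ¬ Function.Injective γ) : F γ = 0 := by
  simp only [Function.Injective, not_forall] at hγ
  obtain ⟨i, j, hij, hne⟩ := hγ
  have h := hF (swap i j) γ
  have e : γ ∘ swap i j = γ := funext fun x => by
    rw [Function.comp_apply, swap_apply_def]; split_ifs <;> simp [*]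
  rw [e, Perm.sign_swap hne] at h
  simp only [Units.val_neg, Units.val_one] at h
  omega

/-- Every exponent vector in the support of `F` is nonnegative and takes all values below `m`. -/
def CoversBelow (m : ℕ) (F : (ι → ℤ) → ℤ) : Prop :=
  ∀ γ, F γ ≠ 0 → (∀ r, 0 ≤ γ r) ∧ ∀ v : ℕ, v < m → ∃ r, γ r = v

omit [DecidableEq ι] in
theorem le_card_lt_of_exists_eq [hne : Nonempty ι] {m : ℕ} {γ : ι → ℤ}
    (h : ∀ v : ℕ, v < m → ∃ r, γ r = v) :
    m ≤ #{r | γ r < m} := by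
  have h' : ∀ v : ℕ, ∃ r, v < m → γ r = v := by
    intro v
    by_cases hv : v < m
    · obtain ⟨r, hr⟩ := h v hv
      exact ⟨r, fun _ => hr⟩
    · obtain ⟨r⟩ := hne
      exact ⟨r, fun h => absurd h hv⟩
  choose p hp using h'
  rw [← card_range m]
  refine card_le_card_of_injOn p (fun v hv => ?_) fun v hv w hw hvw => ?_
  · have := List.mem_range.1 (by simpa using hv)
    simp [hp v this, this]
  · have h1 := hp v (by simpa using hv)
    rw [hvw, hp w (by simpa using hw)] at h1
    exact_mod_cast h1.symm

theorem CoversBelow.mulComplete {F : (ι → ℤ) → ℤ} (hF : IsAlternating F) {m : ℕ}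
    (hc : CoversBelow (m + 1) F) (k : ℕ) : CoversBelow m (mulComplete k F) := by
  intro γ hγ
  have hinj : Function.Injective γ := by
    by_contra h
    exact hγ ((hF.mulComplete k).eq_zero_of_not_injective h)
  have hnn : ∀ r, 0 ≤ γ r := by
    obtain ⟨c, -, h⟩ := exists_ne_zero_of_sum_ne_zero hγ
    intro r
    have := (hc _ h).1 r
    omega
  have hne : Nonempty ι := by
    obtain ⟨c, -, h⟩ := exists_ne_zero_of_sum_ne_zero hγ
    obtain ⟨r, -⟩ := (hc _ h).2 0 (by omega)
    exact ⟨r⟩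
  refine ⟨hnn, ?_⟩
  by_contra! hv
  obtain ⟨v, hvm, hv⟩ := hv
  refine hγ ?_
  have hT : #{r | γ r < m} < m := by
    have h1 : #{r | γ r < m} ≤ #((range m).erase v) := by
      refine card_le_card_of_injOn (fun r => (γ r).toNat) (fun r hr => ?_) fun r _ s _ hrs => ?_
      · simp only [coe_filter, mem_univ, true_and, Set.mem_ofPred_eq] at hr
        simp only [coe_erase, coe_range, Set.mem_sdiff, Set.mem_Iio, Set.mem_singleton_iff]
        have := hv r
        have := hnn r
        omega
      · have := hnn r
        have := hnn s
        simp only at hrs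
        exact hinj (by omega)
    rw [card_erase_of_mem (by simpa using hvm), card_range] at h1
    omega
  let s : Finset (ι → ℤ) := (piAntidiag (univ : Finset ι) k).image fun c r => γ r - c r
  have hs {γ' : ι → ℤ} : γ' ∈ s ↔ (∀ r, γ' r ≤ γ r) ∧ ∑ r, (γ r - γ' r) = k := by
    simp only [s, mem_image, mem_piAntidiag, mem_univ, implies_true, and_true]
    constructor
    · rintro ⟨c, rfl, rfl⟩
      simp
    · rintro ⟨h1, h2⟩
      have h3 r : ((γ r - γ' r).toNat : ℤ) = γ r - γ' r := Int.toNat_of_nonneg (by have := h1 r; omega)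
      refine ⟨fun r => (γ r - γ' r).toNat, ?_, funext fun r => ?_⟩
      · have : ((∑ r, (γ r - γ' r).toNat : ℕ) : ℤ) = k := by
          rw [← h2]; push_cast; exact sum_congr rfl fun r _ => h3 r
        exact_mod_cast this
      · rw [h3]; ring
  have hsum : _root_.mulComplete k F γ = ∑ γ' ∈ s, F γ' := by
    rw [sum_image]
    · rfl
    · intro c _ c' _ h
      funext r
      have := congrFun h r
      simp only at this
      omega
  rw [hsum, ← sum_filter_ne_zero]
  have hchoice (S : Finset ι) : ∃ p : ι × ι, 1 < #S → p.1 ∈ S ∧ p.2 ∈ S ∧ p.1 ≠ p.2 := by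
    by_cases h : 1 < #S
    · obtain ⟨a, ha, b, hb, hab⟩ := one_lt_card.1 h
      exact ⟨(a, b), fun _ => ⟨ha, hb, hab⟩⟩
    · exact ⟨(Classical.arbitrary ι, Classical.arbitrary ι), fun h' => absurd h' h⟩
  choose p hp using hchoice
  let S (γ' : ι → ℤ) : Finset ι := {r | (m : ℤ) ≤ γ r ∧ γ' r < (m + 1 : ℕ)}
  have hScard {γ' : ι → ℤ} (h : F γ' ≠ 0) : 1 < #(S γ') := by
    have h1 := le_card_lt_of_exists_eq (hc γ' h).2
    have h2 : #{r | γ' r < (m + 1 : ℕ)} ≤ #{r | γ r < m} + #(S γ') := by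
      rw [← card_union_of_disjoint]
      · refine card_le_card fun r hr => ?_
        simp only [mem_filter_univ, mem_union, S] at hr ⊢
        omega
      · rw [disjoint_filter]
        intros
        omega
    omega
  let t (γ' : ι → ℤ) : Perm ι := swap (p (S γ')).1 (p (S γ')).2
  have hmemS {γ' : ι → ℤ} (h : F γ' ≠ 0) (r : ι) (hr : t γ' r ≠ r) :
      r ∈ S γ' ∧ t γ' r ∈ S γ' := by
    obtain ⟨h1, h2, -⟩ := hp (S γ') (hScard h)
    simp only [t, swap_apply_def] at hr ⊢
    split_ifs at hr ⊢ with h3 h4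
    · exact ⟨h3 ▸ h1, h2⟩
    · exact ⟨h4 ▸ h2, h1⟩
    · exact absurd rfl hr
  have hSt {γ' : ι → ℤ} (h : F γ' ≠ 0) : S (γ' ∘ t γ') = S γ' := by
    ext r
    by_cases hr : t γ' r = r
    · simp only [S, mem_filter_univ, Function.comp_apply, hr]
    · obtain ⟨h1, h2⟩ := hmemS h r hr
      refine iff_of_true ?_ h1
      simp only [S, mem_filter_univ, Function.comp_apply] at h1 h2 ⊢
      exact ⟨h1.1, h2.2⟩
  have hsign {γ' : ι → ℤ} (h : F γ' ≠ 0) : F (γ' ∘ t γ') = - F γ' := by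
    rw [hF, Perm.sign_swap (hp (S γ') (hScard h)).2.2]
    simp
  refine sum_involution (fun γ' _ => γ' ∘ t γ') (fun γ' h => ?_) (fun γ' h _ => ?_)
    (fun γ' h => ?_) fun γ' h => ?_
  · rw [hsign (mem_filter.1 h).2]; ring
  · intro e
    have h0 := (mem_filter.1 h).2
    have := hsign h0
    rw [e] at this
    omega
  · rw [mem_filter, hs] at h ⊢
    obtain ⟨⟨h1, h2⟩, h0⟩ := h
    refine ⟨⟨fun r => ?_, ?_⟩, ?_⟩
    · by_cases hr : t γ' r = r
      · rw [Function.comp_apply, hr]; exact h1 r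
      · obtain ⟨h3, h4⟩ := hmemS h0 r hr
        simp only [S, mem_filter_univ, Function.comp_apply] at h3 h4 ⊢
        omega
    · rw [← h2, sum_sub_distrib, sum_sub_distrib]
      congr 1
      exact Equiv.sum_comp (t γ') γ'
    · rw [hsign h0]; exact neg_ne_zero.2 h0
  · have h0 := (mem_filter.1 h).2
    have : t (γ' ∘ t γ') = t γ' := by simp only [t, hSt h0]
    simp only [this]
    ext r
    simp [t]

/-- The coefficient of `x ^ γ` in `a_δ h_{ν 0} ⋯ h_{ν (k - 1)}`. -/
def alternantMulComplete (δ : ι → ℕ) (ν : ℕ → ℕ) : ℕ → (ι → ℤ) → ℤ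
  | 0 => alternant δ
  | k + 1 => mulComplete (ν k) (alternantMulComplete δ ν k)

theorem isAlternating_alternantMulComplete (δ : ι → ℕ) (ν : ℕ → ℕ) (k : ℕ) :
    IsAlternating (alternantMulComplete δ ν k) := by
  induction k with
  | zero => exact isAlternating_alternant δ
  | succ k ih => exact ih.mulComplete (ν k)

theorem coversBelow_alternantMulComplete {ν : ℕ → ℕ} {m : ℕ}
    (hδ : ∀ v < m, ∃ r, δ r = v) (k : ℕ) (hk : k ≤ m) :
    CoversBelow (m - k) (alternantMulComplete δ ν k) := by
  induction k with
  | zero =>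
    intro γ hγ
    obtain ⟨σ, hσ⟩ := exists_perm_of_alternant_ne_zero hγ
    refine ⟨fun r => by simp [hσ r], fun v hv => ?_⟩
    obtain ⟨r, hr⟩ := hδ v hv
    exact ⟨σ⁻¹ r, by simp [hσ, hr]⟩
  | succ k ih =>
    have := ih (by omega)
    rw [show m - k = m - (k + 1) + 1 by omega] at this
    exact this.mulComplete (isAlternating_alternantMulComplete δ ν k) (ν k)

theorem exists_le_of_alternantMulComplete_ne_zero {ν : ℕ → ℕ} (k j : ℕ) {γ : ι → ℤ}
    (h : alternantMulComplete δ ν (k + j) γ ≠ 0) :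
    ∃ γ' : ι → ℤ, (∀ r, γ' r ≤ γ r) ∧ alternantMulComplete δ ν k γ' ≠ 0 ∧
      ∑ r, γ' r + ∑ s ∈ range j, (ν (k + s) : ℤ) = ∑ r, γ r := by
  induction j generalizing γ with
  | zero => exact ⟨γ, fun _ => le_rfl, h, by simp⟩
  | succ j ih =>
    obtain ⟨c, hc, hne⟩ := exists_ne_zero_of_sum_ne_zero h
    obtain ⟨γ', h1, h2, h3⟩ := ih hne
    refine ⟨γ', fun r => (h1 r).trans (by omega), h2, ?_⟩
    rw [sum_range_succ, ← add_assoc, h3, sum_sub_distrib, ← Nat.cast_sum, (mem_piAntidiag.1 hc).1]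
    exact sub_add_cancel _ _

theorem alternantMulComplete_eq_sum (δ : ι → ℕ) (ν : ℕ → ℕ) (k : ℕ) (γ : ι → ℤ) :
    alternantMulComplete δ ν k γ =
      ∑ M ∈ Fintype.piFinset fun s : Fin k => piAntidiag (univ : Finset ι) (ν s),
        alternant δ (fun r => γ r - ∑ s, (M s r : ℤ)) := by
  induction k generalizing γ with
  | zero => simp [alternantMulComplete]
  | succ k ih =>
    rw [alternantMulComplete, mulComplete, sum_congr rfl fun c _ => ih _, ← sum_product']
    refine sum_bij' (fun x _ => Fin.snoc (α := fun _ => ι → ℕ) x.2 x.1)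
      (fun M _ => (M (Fin.last k), Fin.init M)) ?_ ?_ ?_ ?_ ?_
    · intro x hx
      rw [mem_product, Fintype.mem_piFinset] at hx
      rw [Fintype.mem_piFinset]
      intro s
      refine Fin.lastCases ?_ (fun s => ?_) s
      · simpa using hx.1
      · simpa using hx.2 s
    · intro M hM
      rw [Fintype.mem_piFinset] at hM
      rw [mem_product, Fintype.mem_piFinset]
      exact ⟨hM (Fin.last k), fun s => hM s.castSucc⟩
    · intro x _
      simp
    · intro M _
      simp
    · intro x _
      congr 1
      funext r
      rw [Fin.sum_univ_castSucc]
      simp only [Fin.snoc_castSucc, Fin.snoc_last]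
      ring

end alternant

open Coloring

/-- The exponent vector `(L - 1, L - 2, …, 0)`. -/
def staircase (L : ℕ) (r : Fin L) : ℕ := L - 1 - r

theorem staircase_injective (L : ℕ) : Function.Injective (staircase L) := by
  intro r s h
  simp only [staircase] at h
  ext
  omega

theorem exists_staircase_eq {L v : ℕ} (hv : v < L) : ∃ r, staircase L r = v :=
  ⟨⟨L - 1 - v, by omega⟩, by simp only [staircase]; omega⟩

/-- The first `K` elements of `Fin L`. -/
def initialSegment (L K : ℕ) : Finset (Fin L) := {r | r.val < K}

theorem mem_initialSegment {L K : ℕ} {r : Fin L} : r ∈ initialSegment L K ↔ (r : ℕ) < K := by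
  simp [initialSegment]

theorem card_initialSegment {L K : ℕ} (hK : K ≤ L) : #(initialSegment L K) = K := by
  rw [initialSegment, Fin.card_filter_val_lt, min_eq_right hK]

theorem Antitone.sum_le_sum_initial {L : ℕ} {β : Fin L → ℤ} (hβ : Antitone β) {S : Finset (Fin L)}
    {K : ℕ} (hS : #S = K) : ∑ r ∈ S, β r ≤ ∑ r ∈ initialSegment L K, β r := by
  have hK : K ≤ L := by
    rw [← hS]; exact (card_le_univ S).trans (by simp)
  set I := initialSegment L K with hI
  have hIc : #I = #S := by rw [hI, card_initialSegment hK, hS]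
  have hcard : #(S \ I) = #(I \ S) := by
    have h1 := card_sdiff_add_card_inter S I
    have h2 := card_sdiff_add_card_inter I S
    rw [inter_comm] at h2
    omega
  rw [← sum_inter_add_sum_sdiff S I, ← sum_inter_add_sum_sdiff I S, inter_comm S I]
  gcongr _ + ?_
  obtain h | ⟨s, hs⟩ := (S \ I).eq_empty_or_nonempty
  · rw [h, card_empty] at hcard
    rw [h, card_eq_zero.1 hcard.symm]
  · have hKL : K < L := by
      simp only [hI, mem_sdiff, mem_initialSegment] at hs
      omega
    calc ∑ r ∈ S \ I, β r ≤ #(S \ I) • β ⟨K, hKL⟩ := by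
          refine sum_le_card_nsmul _ _ _ fun r hr => hβ ?_
          simp only [hI, mem_sdiff, mem_initialSegment] at hr
          exact Fin.le_def.2 (by simp; omega)
      _ = #(I \ S) • β ⟨K, hKL⟩ := by rw [hcard]
      _ ≤ ∑ r ∈ I \ S, β r := by
          refine card_nsmul_le_sum _ _ _ fun r hr => hβ ?_
          simp only [hI, mem_sdiff, mem_initialSegment] at hr
          exact Fin.le_def.2 (by simp; omega)

theorem antitone_staircase (L : ℕ) : Antitone fun r => (staircase L r : ℤ) := by
  intro r s h
  have := Fin.le_def.1 h
  simp only [staircase]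
  omega

theorem sum_staircase_perm_le {L : ℕ} (σ : Perm (Fin L)) (K : ℕ) :
    ∑ r ∈ initialSegment L K, (staircase L (σ r) : ℤ) ≤ ∑ r ∈ initialSegment L K, (staircase L r : ℤ) := by
  by_cases hK : K ≤ L
  · have h := (antitone_staircase L).sum_le_sum_initial (K := K)
      (S := (initialSegment L K).map σ.toEmbedding)
      (by rw [card_map, card_initialSegment hK])
    rwa [sum_map] at h
  · have : initialSegment L K = univ := by
      ext r; simp only [mem_initialSegment, mem_univ, iff_true]; omega
    rw [this, Equiv.sum_comp σ fun r => (staircase L r : ℤ)]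

theorem perm_eq_one_of_sum_staircase_le {L : ℕ} {σ : Perm (Fin L)}
    (h : ∀ K, ∑ r ∈ initialSegment L K, (staircase L r : ℤ) ≤
      ∑ r ∈ initialSegment L K, (staircase L (σ r) : ℤ)) : σ = 1 := by
  have key (k : ℕ) : ∀ r : Fin L, (r : ℕ) = k → σ r = r := by
    induction k using Nat.strong_induction_on with
    | _ k ih =>
      rintro r rfl
      have hsplit (g : Fin L → ℤ) : ∑ s ∈ initialSegment L (r + 1), g s =
          g r + ∑ s ∈ initialSegment L r, g s := by
        rw [← sum_insert (by simp [mem_initialSegment])]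
        congr 1
        ext s
        simp only [mem_initialSegment, mem_insert, Fin.ext_iff]
        omega
      have h1 := h (r + 1)
      have h0 : ∑ s ∈ initialSegment L r, (staircase L (σ s) : ℤ) =
          ∑ s ∈ initialSegment L r, (staircase L s : ℤ) :=
        sum_congr rfl fun s hs => by rw [ih s (mem_initialSegment.1 hs) s rfl]
      rw [hsplit, hsplit, h0] at h1
      have h2 : (σ r : ℕ) ≤ r := by
        have := (σ r).2
        simp only [staircase] at h1
        omega
      obtain h3 | h3 := h2.lt_or_eq
      · exact σ.injective (ih _ h3 _ rfl)
      · exact Fin.ext h3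
  exact Equiv.ext fun r => key r r rfl

namespace Nat.Partition

variable {n : ℕ}

theorem row_lt (lam : n.Partition) (i : Fin n) : lam.row i < n := by
  have h1 := lam.card_col_eq_row_lt (lam.col i) (lam.row i + 1)
  have h2 := YoungDiagram.mem_iff_lt_colLen.1 (lam.mem_youngDiagram_row_col i)
  rw [min_eq_right (by omega)] at h1
  have h3 : #{j | lam.col j = lam.col i ∧ lam.row j < lam.row i + 1} ≤ n :=
    (card_le_univ _).trans (by simp)
  omega

/-- The colouring of the letters by their rows. -/
noncomputable def rowColor (lam : n.Partition) {L : ℕ} (hL : n ≤ L) (i : Fin n) : Fin L :=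
  ⟨lam.row i, (lam.row_lt i).trans_le hL⟩

theorem content_rowColor (lam : n.Partition) {L : ℕ} (hL : n ≤ L) (r : Fin L) :
    content (lam.rowColor hL) r = lam.youngDiagram.rowLen r := by
  rw [← card_row_eq, content]
  simp [rowColor, Fin.ext_iff]

theorem card_color_lt {L : ℕ} (f : Fin n → Fin L) (K : ℕ) :
    #{i | (f i : ℕ) < K} = ∑ r ∈ initialSegment L K, content f r := by
  rw [card_eq_sum_card_fiberwise (f := f) (t := initialSegment L K) (fun i hi => by
    simpa [mem_initialSegment] using hi)]
  refine sum_congr rfl fun r hr => ?_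
  rw [filter_filter, content]
  congr 1
  ext i
  simp only [mem_filter_univ, mem_initialSegment, and_iff_right_iff_imp] at hr ⊢
  rintro rfl
  exact hr

theorem card_row_lt_eq_sum_rowLen (lam : n.Partition) {L : ℕ} (hL : n ≤ L) (K : ℕ) :
    #{i | lam.row i < K} = ∑ r ∈ initialSegment L K, lam.youngDiagram.rowLen r := by
  rw [← sum_congr rfl fun r _ => lam.content_rowColor hL r, ← card_color_lt]
  rfl

theorem ColumnInjective.sum_content_le {lam : n.Partition} {L : ℕ} {f : Fin n → Fin L}
    (hf : lam.ColumnInjective f) (K : ℕ) :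
    ∑ r ∈ initialSegment L K, content f r ≤ #{i | lam.row i < K} := by
  rw [← card_color_lt]
  refine ColumnInjective.card_lt_le (f := fun i => (f i : ℕ)) (fun i j h hc => ?_) K
  exact hf i j (Fin.ext h) hc

/-- The virtual character whose value is given by Frobenius' formula: the coefficient of
`x ^ (lam + δ)` in the product of `a_δ` and the power sums of the cycles. -/
noncomputable def frobeniusCharacter (lam : n.Partition) (L : ℕ) : Perm (Fin n) → ℂ :=
  colorSum fun c : Fin L → ℕ => (alternant (staircase L)
    fun r => lam.youngDiagram.rowLen r + staircase L r - c r : ℂ)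

theorem mult_frobeniusCharacter_eq_zero {lam mu : n.Partition} {L : ℕ} (hL : n ≤ L)
    (h : ¬ lam.DominatedBy mu) : mu.mult (lam.frobeniusCharacter L) = 0 := by
  refine mult_colorSum_eq_zero fun f hf => ?_
  by_contra hne
  obtain ⟨σ, hσ⟩ := exists_perm_of_alternant_ne_zero (Int.cast_ne_zero.1 hne)
  refine h fun K => ?_
  have h1 := hf.sum_content_le K
  have h2 := sum_staircase_perm_le σ K
  simp only [← hσ, sum_sub_distrib, sum_add_distrib] at h2
  rw [card_row_lt_eq_sum_rowLen lam hL]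
  zify at h1 ⊢
  linarith

theorem mult_frobeniusCharacter_self (lam : n.Partition) {L : ℕ} (hL : n ≤ L) :
    lam.mult (lam.frobeniusCharacter L) = 1 := by
  rw [frobeniusCharacter, mult_colorSum_eq (f₀ := lam.rowColor hL) Fin.val_injective rfl]
  · have : (fun r : Fin L => (lam.youngDiagram.rowLen r : ℤ) + staircase L r -
        content (lam.rowColor hL) r) = fun r => (staircase L r : ℤ) := by
      funext r
      rw [content_rowColor]
      ring
    rw [this, alternant_self (staircase_injective L), Int.cast_one]
  · intro f hf hne
    obtain ⟨σ, hσ⟩ := exists_perm_of_alternant_ne_zero (Int.cast_ne_zero.1 hne)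
    have h1 : σ = 1 := by
      refine perm_eq_one_of_sum_staircase_le fun K => ?_
      have h2 := hf.sum_content_le K
      rw [card_row_lt_eq_sum_rowLen lam hL] at h2
      simp only [← hσ, sum_sub_distrib, sum_add_distrib]
      zify at h2
      linarith
    funext r
    have := hσ r
    rw [h1] at this
    rw [content_rowColor]
    simp only [Perm.coe_one, id_eq] at this
    omega

/-- The permutation character of the Young subgroup of `lam`. -/
noncomputable def youngCharacter (lam : n.Partition) (L : ℕ) : Perm (Fin n) → ℂ :=
  colorSum fun c : Fin L → ℕ => if ∀ r, c r = lam.youngDiagram.rowLen r then 1 else 0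

theorem mult_youngCharacter_eq_zero {lam mu : n.Partition} {L : ℕ} (hL : n ≤ L)
    (h : ¬ lam.DominatedBy mu) : mu.mult (lam.youngCharacter L) = 0 := by
  refine mult_colorSum_eq_zero fun f hf => ?_
  rw [if_neg]
  intro hc
  refine h fun K => ?_
  rw [card_row_lt_eq_sum_rowLen lam hL, ← sum_congr rfl fun r _ => hc r]
  exact hf.sum_content_le K

theorem mult_youngCharacter_self (lam : n.Partition) {L : ℕ} (hL : n ≤ L) :
    lam.mult (lam.youngCharacter L) = 1 := by
  rw [youngCharacter, mult_colorSum_eq (f₀ := lam.rowColor hL) Fin.val_injective rfl, if_pos]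
  · exact fun r => lam.content_rowColor hL r
  · intro f _ hne
    have := (ite_ne_right_iff.1 hne).1
    funext r
    rw [this, content_rowColor]

theorem sum_rowLen (lam : n.Partition) {L : ℕ} (hL : n ≤ L) :
    ∑ r : Fin L, lam.youngDiagram.rowLen r = n := by
  rw [← sum_congr rfl fun r _ => lam.content_rowColor hL r, sum_content, Fintype.card_fin]

theorem sum_frobeniusCharacter_mul_youngCharacter (lam nu : n.Partition) {L : ℕ} (hL : n ≤ L) :
    ∑ w, lam.frobeniusCharacter L w * nu.youngCharacter L w = (n.factorial : ℂ) *
      (alternantMulComplete (staircase L) nu.youngDiagram.rowLen L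
        fun r => lam.youngDiagram.rowLen r + staircase L r : ℂ) := by
  rw [frobeniusCharacter, youngCharacter, sum_colorSum_mul_colorSum, Fintype.card_fin,
    alternantMulComplete_eq_sum, Int.cast_sum]
  congr 1
  simp only [mul_ite, mul_one, mul_zero]
  rw [← sum_filter]
  refine sum_bij' (fun M _ s r => M (r, s)) (fun M _ x => M x.2 x.1) ?_ ?_ ?_ ?_ ?_
  · intro M hM
    rw [mem_filter] at hM
    rw [Fintype.mem_piFinset]
    intro s
    simpa using hM.2 s
  · intro M hM
    rw [Fintype.mem_piFinset] at hM
    have h (s : Fin L) : ∑ r, M s r = nu.youngDiagram.rowLen s := by simpa using hM s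
    rw [mem_filter]
    refine ⟨?_, h⟩
    rw [mem_piAntidiag, Fintype.sum_prod_type_right]
    simp [h, nu.sum_rowLen hL]
  · intro M _
    rfl
  · intro M _
    rfl
  · intro M _
    simp

theorem sum_range_rowLen (lam : n.Partition) (K j : ℕ) :
    #{i | lam.row i < K} + ∑ s ∈ range j, lam.youngDiagram.rowLen (K + s) =
      #{i | lam.row i < K + j} := by
  induction j with
  | zero => simp
  | succ j ih => rw [sum_range_succ, ← add_assoc, ih, ← add_assoc, card_row_lt_succ]

theorem card_row_lt_of_le (lam : n.Partition) {K : ℕ} (hK : n ≤ K) : #{i | lam.row i < K} = n := by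
  rw [filter_true_of_mem fun i _ => (lam.row_lt i).trans_le hK]
  simp

theorem sum_staircase_ge {L K : ℕ} (hK : K ≤ L) :
    ∑ r ∈ (initialSegment L K)ᶜ, (staircase L r : ℤ) = ∑ v ∈ range (L - K), (v : ℤ) := by
  refine sum_bij (fun r _ => staircase L r) ?_ ?_ ?_ ?_
  · intro r hr
    simp only [mem_compl, mem_initialSegment, mem_range, staircase] at hr ⊢
    omega
  · intro r _ s _ h
    exact staircase_injective L h
  · intro v hv
    rw [mem_range] at hv
    obtain ⟨r, hr⟩ := exists_staircase_eq (L := L) (v := v) (by omega)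
    refine ⟨r, ?_, hr⟩
    simp only [mem_compl, mem_initialSegment, staircase] at hr ⊢
    omega
  · intros
    rfl

theorem dominatedBy_of_alternantMulComplete_ne_zero {lam nu : n.Partition} {L : ℕ} (hL : n ≤ L)
    (h : alternantMulComplete (staircase L) nu.youngDiagram.rowLen L
      (fun r => lam.youngDiagram.rowLen r + staircase L r) ≠ 0) : nu.DominatedBy lam := by
  intro K
  by_cases hK : K < L
  swap
  · rw [card_row_lt_of_le lam (by omega)]
    exact (card_le_univ _).trans (by simp)
  obtain ⟨j, hj⟩ := Nat.exists_eq_add_of_lt hK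
  set β : Fin L → ℤ := fun r => lam.youngDiagram.rowLen r + staircase L r with hβ
  have hanti : Antitone β := by
    intro r s hrs
    have := lam.youngDiagram.rowLen_anti r s hrs
    have := antitone_staircase L hrs
    simp only [hβ] at this ⊢
    omega
  obtain ⟨γ, hle, hne, hsum⟩ := exists_le_of_alternantMulComplete_ne_zero K (L - K) (γ := β)
    (by rwa [Nat.add_sub_cancel' hK.le])
  obtain ⟨-, hcov⟩ := coversBelow_alternantMulComplete (fun v hv => exists_staircase_eq hv) K hK.le
    γ hne
  have hr0 : Nonempty (Fin L) := ⟨⟨K, hK⟩⟩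
  choose! p hp using hcov
  have hpinj : Set.InjOn p (range (L - K) : Set ℕ) := by
    intro v hv w hw hvw
    have h1 := hp v (by simpa using hv)
    rw [hvw, hp w (by simpa using hw)] at h1
    exact_mod_cast h1.symm
  set Q := (range (L - K)).image p with hQ
  have hQcard : #Q = L - K := by rw [hQ, Finset.card_image_of_injOn hpinj, card_range]
  have hQsum : ∑ r ∈ Q, γ r = ∑ v ∈ range (L - K), (v : ℤ) := by
    rw [hQ, sum_image hpinj]
    exact sum_congr rfl fun v hv => hp v (mem_range.1 hv)
  have hQc : ∑ r ∈ Qᶜ, γ r ≤ ∑ r ∈ initialSegment L K, β r :=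
    (sum_le_sum fun r _ => hle r).trans (hanti.sum_le_sum_initial (by
      rw [card_compl, hQcard, Fintype.card_fin]; omega))
  have h1 := sum_add_sum_compl Q γ
  have h2 : ∑ r, β r = n + ∑ r, (staircase L r : ℤ) := by
    rw [hβ, sum_add_distrib]
    congr 1
    exact_mod_cast lam.sum_rowLen hL
  have h3 := sum_add_sum_compl (initialSegment L K) fun r => (staircase L r : ℤ)
  rw [sum_staircase_ge hK.le] at h3
  have h4 := nu.sum_range_rowLen K (L - K)
  rw [Nat.add_sub_cancel' hK.le, nu.card_row_lt_of_le hL] at h4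
  have h5 : ∑ r ∈ initialSegment L K, β r = #{i | lam.row i < K} +
      ∑ r ∈ initialSegment L K, (staircase L r : ℤ) := by
    rw [hβ, sum_add_distrib, card_row_lt_eq_sum_rowLen lam hL, Nat.cast_sum]
  have h4' : (#{i | nu.row i < K} : ℤ) +
      ∑ s ∈ range (L - K), (nu.youngDiagram.rowLen (K + s) : ℤ) = n := by exact_mod_cast h4
  rw [← Nat.cast_le (α := ℤ)]
  linarith

/-- **Frobenius' character formula.** -/
theorem irreducibleCharacter_eq_frobeniusCharacter (lam : n.Partition) {L : ℕ} (hL : n ≤ L) :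
    lam.irreducibleCharacter = lam.frobeniusCharacter L := by
  have hF : IsClassFunction (lam.frobeniusCharacter L) := isClassFunction_colorSum _
  have hY (mu : n.Partition) : IsClassFunction (mu.youngCharacter L) := isClassFunction_colorSum _
  have hzero (mu : n.Partition) : mu ≠ lam → mu.mult (lam.frobeniusCharacter L) = 0 := by
    let r : n.Partition → n.Partition → Prop := fun a b => b.DominatedBy a ∧ a ≠ b
    have : IsTrans _ r := ⟨fun a b c h1 h2 => ⟨h2.1.trans h1.1, fun h => h1.2 (by
      subst h; exact h2.1.antisymm h1.1 |>.symm ▸ rfl)⟩⟩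
    have : Std.Irrefl r := ⟨fun a h => h.2 rfl⟩
    have hwf : WellFounded r := Finite.wellFounded_of_trans_of_irrefl r
    induction mu using hwf.induction with
    | _ mu ih =>
      intro hne
      by_cases hdom : lam.DominatedBy mu
      swap
      · exact mult_frobeniusCharacter_eq_zero hL hdom
      have h1 : ∑ w, lam.frobeniusCharacter L w * mu.youngCharacter L w = 0 := by
        rw [sum_frobeniusCharacter_mul_youngCharacter lam mu hL]
        by_contra h
        have h' := Int.cast_ne_zero.1 (right_ne_zero_of_mul h)
        exact hne ((dominatedBy_of_alternantMulComplete_ne_zero hL h').antisymm hdom)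
      rw [hF.sum_mul (hY mu)] at h1
      have hn : (n.factorial : ℂ) ≠ 0 := by exact_mod_cast n.factorial_ne_zero
      have h2 := (_root_.mul_eq_zero.1 h1).resolve_left hn
      rw [sum_eq_single mu, mult_youngCharacter_self mu hL, one_mul] at h2
      · exact h2
      · intro rho _ hrho
        by_cases hd : mu.DominatedBy rho
        · rw [ih rho ⟨hd, hrho⟩ (fun h => hne ?_), mul_zero]
          subst h
          exact hd.antisymm hdom
        · rw [mult_youngCharacter_eq_zero hL hd, zero_mul]
      · simp
  funext w
  rw [hF.eq_sum_mult w, sum_eq_single lam, mult_frobeniusCharacter_self lam hL, one_mul]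
  · intro mu _ hne
    rw [hzero mu hne, zero_mul]
  · simp

end Nat.Partition

/-! ### Divisibility -/

theorem MulAction.card_dvd_sum {G X : Type*} [Group G] [Fintype G] [Fintype X] [MulAction G X]
    {E : X → ℤ} (hE : ∀ (g : G) x, E (g • x) = E x)
    (hfree : ∀ x, E x ≠ 0 → ∀ g : G, g • x = x → g = 1) : (Fintype.card G : ℤ) ∣ ∑ x, E x := by
  classical
  rw [← sum_fiberwise_of_maps_to (s := univ) (t := univ)
    (g := fun x : X => (Quotient.mk (MulAction.orbitRel G X) x)) (fun _ _ => mem_univ _)]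
  refine dvd_sum fun ω _ => ?_
  induction ω using Quotient.inductionOn with
  | _ x =>
    have hconst : ∀ y ∈ ({y | Quotient.mk (MulAction.orbitRel G X) y = ⟦x⟧} : Finset X),
        E y = E x := by
      intro y hy
      obtain ⟨g, rfl⟩ := Quotient.exact ((mem_filter_univ y).1 hy)
      exact hE g x
    rw [sum_congr rfl hconst, sum_const, nsmul_eq_mul]
    by_cases hx : E x = 0
    · simp [hx]
    have horb : #{y | Quotient.mk (MulAction.orbitRel G X) y = ⟦x⟧} =
        Fintype.card (MulAction.orbit G x) := by
      rw [← Set.toFinset_card]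
      congr 1
      ext y
      rw [mem_filter_univ, Quotient.eq, Set.mem_toFinset]
      rfl
    have hstab : Fintype.card (MulAction.stabilizer G x) = 1 := by
      rw [Fintype.card_eq_one_iff]
      refine ⟨1, fun g => Subtype.ext (hfree x hx g g.2)⟩
    have h := MulAction.card_orbit_mul_card_stabilizer_eq_card_group G x
    rw [hstab, mul_one] at h
    rw [horb, h]
    exact dvd_mul_right _ _

theorem factorial_dvd_sum_of_surjective {α : Type*} [Fintype α] [DecidableEq α] {d : ℕ}
    {E : (α → Fin d) → ℤ} (hE : ∀ (π : Perm (Fin d)) f, E (π ∘ f) = E f)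
    (hsurj : ∀ f, E f ≠ 0 → Function.Surjective f) : (d.factorial : ℤ) ∣ ∑ f, E f := by
  have h := MulAction.card_dvd_sum (G := Perm (Fin d)) (X := α → Fin d) (E := E)
    (fun π f => hE π f) fun f hf π hπ => Equiv.ext fun j => by
      obtain ⟨i, rfl⟩ := hsurj f hf j
      exact congrFun hπ i
  rwa [Fintype.card_perm, Fintype.card_fin] at h

theorem Equiv.Perm.dvd_card_of_forall_dvd {α : Type*} [Fintype α] [DecidableEq α] {w : Perm α}
    {q : ℕ} (hq : ∀ p ∈ w.partition.parts, q ∣ p) {S : Finset α} (hS : ∀ i, w i ∈ S ↔ i ∈ S) :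
    q ∣ #S := by
  classical
  have hzpow (k : ℤ) (i : α) : (w ^ k) i ∈ S ↔ i ∈ S := by
    induction k using Int.induction_on with
    | zero => simp
    | succ k ih => rw [add_comm, zpow_add, zpow_one, Perm.mul_apply, hS, ih]
    | pred k ih =>
      rw [← ih, ← hS ((w ^ (-(k : ℤ) - 1)) i), ← Perm.mul_apply, ← zpow_one_add]
      congr! 3
      ring
  rw [card_eq_sum_card_fiberwise (f := fun i => Quotient.mk (Perm.SameCycle.setoid w) i)
    (t := univ) (fun _ _ => mem_univ _)]
  refine dvd_sum fun ω _ => ?_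
  obtain h | ⟨x, hx⟩ := ({i ∈ S | Quotient.mk (Perm.SameCycle.setoid w) i = ω} :
    Finset α).eq_empty_or_nonempty
  · rw [h]; simp
  obtain ⟨hxS, rfl⟩ := mem_filter.1 hx
  have hset : ({i ∈ S | Quotient.mk (Perm.SameCycle.setoid w) i = ⟦x⟧} : Finset α) =
      ({i | w.SameCycle x i} : Finset α) := by
    ext i
    rw [mem_filter, mem_filter_univ, Quotient.eq]
    constructor
    · rintro ⟨-, h⟩
      exact Perm.SameCycle.symm h
    · intro h
      refine ⟨?_, h.symm⟩
      obtain ⟨k, rfl⟩ := h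
      exact (hzpow k x).2 hxS
  rw [hset]
  by_cases hfix : w x = x
  · have h1 : q ∣ 1 := by
      refine hq 1 ?_
      rw [Perm.parts_partition, Multiset.mem_add]
      refine Or.inr (Multiset.mem_replicate.2 ⟨?_, rfl⟩)
      have : #w.support < Fintype.card α := by
        refine card_lt_univ_of_notMem (x := x) ?_
        simpa using hfix
      omega
    exact (Nat.dvd_one.1 h1) ▸ one_dvd _
  · refine hq _ ?_
    rw [Perm.parts_partition, Multiset.mem_add]
    refine Or.inl ?_
    have hsupp : ({i | w.SameCycle x i} : Finset α) = (w.cycleOf x).support := by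
      ext i
      rw [mem_filter_univ, Perm.mem_support_cycleOf_iff' hfix]
    rw [hsupp, Perm.cycleType_def]
    exact Multiset.mem_map.2 ⟨w.cycleOf x, Perm.cycleOf_mem_cycleFactorsFinset_iff.2
      (Perm.mem_support.2 hfix), rfl⟩

theorem Coloring.dvd_content {α ι : Type*} [Fintype α] [DecidableEq α] [DecidableEq ι] {w : Perm α}
    {q : ℕ} (hq : ∀ p ∈ w.partition.parts, q ∣ p) {f : α → ι} (hf : ∀ i, f (w i) = f i) (r : ι) :
    q ∣ content f r :=
  w.dvd_card_of_forall_dvd hq fun i => by simp [hf]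

/-! ### Row lengths of the box partition -/

namespace Nat.Partition

variable {n : ℕ}

theorem colLen_youngDiagram (lam : n.Partition) (c : ℕ) :
    lam.youngDiagram.colLen c = lam.parts.countP (c < ·) := by
  have h : lam.parts = (Multiset.range (lam.youngDiagram.colLen 0)).map lam.youngDiagram.rowLen := by
    rw [← Multiset.sort_eq lam.parts (· ≥ ·), ← rowLens_youngDiagram]
    rfl
  rw [h, Multiset.countP_map, ← card_range (lam.youngDiagram.colLen c)]
  change _ = #{r ∈ range (lam.youngDiagram.colLen 0) | c < lam.youngDiagram.rowLen r}
  congr 1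
  ext r
  rw [mem_filter, mem_range, mem_range, ← YoungDiagram.mem_iff_lt_rowLen,
    YoungDiagram.mem_iff_lt_colLen]
  have := lam.youngDiagram.colLen_anti 0 c (by omega)
  omega

theorem countP_boxPlus (d : ℕ) (hd : 0 < d) (lam : n.Partition) (c : ℕ) :
    (lam.boxPlus d hd).parts.countP (c < ·) = d * lam.parts.countP (c / d < ·) := by
  change (lam.parts.bind fun i => Multiset.replicate d (d * i)).countP (c < ·) = _
  induction lam.parts using Multiset.induction_on with
  | empty => simp
  | cons i s ih =>
    rw [Multiset.cons_bind, Multiset.countP_add, ih, Multiset.countP_cons, mul_add,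
      ← Multiset.coe_replicate, Multiset.coe_countP, List.countP_replicate]
    simp only [Nat.div_lt_iff_lt_mul hd, mul_comm i d, decide_eq_true_eq]
    split_ifs <;> ring

theorem rowLen_boxPlus (d : ℕ) (hd : 0 < d) (lam : n.Partition) (a : ℕ) {j : ℕ} (hj : j < d) :
    (lam.boxPlus d hd).youngDiagram.rowLen (j + d * a) = d * lam.youngDiagram.rowLen a := by
  refine eq_of_forall_lt_iff fun c => ?_
  rw [← YoungDiagram.mem_iff_lt_rowLen, YoungDiagram.mem_iff_lt_colLen, colLen_youngDiagram,
    countP_boxPlus, ← colLen_youngDiagram, mul_comm d (lam.youngDiagram.rowLen a),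
    ← Nat.div_lt_iff_lt_mul hd, ← YoungDiagram.mem_iff_lt_rowLen, YoungDiagram.mem_iff_lt_colLen]
  generalize lam.youngDiagram.colLen (c / d) = x
  constructor
  · intro h
    by_contra! h'
    have := Nat.mul_le_mul_left d h'
    omega
  · intro h
    have := Nat.mul_le_mul_left d h
    rw [Nat.mul_succ] at this
    omega

end Nat.Partition

/-! ### Factorization of the alternant -/

theorem alternant_comp_equiv {ι κ : Type*} [Fintype ι] [DecidableEq ι] [Fintype κ] [DecidableEq κ]
    (e : κ ≃ ι) (δ : ι → ℕ) (γ : ι → ℤ) : alternant (δ ∘ e) (γ ∘ e) = alternant δ γ :=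
  Matrix.det_submatrix_equiv_self e (Matrix.of fun r s => if γ r = δ s then (1 : ℤ) else 0)

theorem staircase_lt {d : ℕ} (j : Fin d) : staircase d j < d := by
  have := j.2
  simp only [staircase]
  omega

theorem staircase_mul {l d : ℕ} (a : Fin l) (j : Fin d) :
    staircase (l * d) (finProdFinEquiv (a, j)) = d * staircase l a + staircase d j := by
  obtain ⟨b, hb⟩ := Nat.exists_eq_add_of_lt a.2
  have := j.2
  simp only [staircase, finProdFinEquiv_apply_val]
  have h1 : l * d = d * a + d * b + d := (congrArg (· * d) hb).trans (by ring)
  have h2 : l - 1 - a = b := by omega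
  rw [h2, h1]
  omega

theorem alternant_staircase_mul {l d : ℕ} (g : Fin d → Fin l → ℤ) :
    alternant (staircase (l * d) ∘ finProdFinEquiv)
      (fun x : Fin l × Fin d => d * g x.2 x.1 + staircase d x.2) =
      ∏ j, alternant (staircase l) (g j) := by
  unfold alternant
  rw [← Matrix.det_blockDiagonal]
  congr 1
  ext ⟨a, j⟩ ⟨a', j'⟩
  rw [Matrix.blockDiagonal_apply]
  simp only [Matrix.of_apply, Function.comp_apply, staircase_mul]
  have hj := staircase_lt j
  have hj' := staircase_lt j'
  have hd : d ≠ 0 := by omega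
  push_cast
  by_cases h : j = j'
  · subst h
    simp [hd]
  · rw [if_neg h, if_neg]
    intro h'
    refine h (staircase_injective d ?_)
    have h1 := congrArg (· % (d : ℤ)) h'
    simp only [Int.mul_add_emod_self_left] at h1
    rw [Int.emod_eq_of_lt (by omega) (by omega), Int.emod_eq_of_lt (by omega) (by omega)] at h1
    exact_mod_cast h1

theorem sum_eq_of_alternant_ne_zero {ι : Type*} [Fintype ι] [DecidableEq ι] {δ : ι → ℕ}
    {u : ι → ℤ} {c : ι → ℤ} (h : alternant δ (fun r => u r + δ r - c r) ≠ 0) :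
    ∑ r, c r = ∑ r, u r := by
  obtain ⟨σ, hσ⟩ := exists_perm_of_alternant_ne_zero h
  have h1 := sum_congr rfl fun r (_ : r ∈ univ) => hσ r
  rw [Equiv.sum_comp σ fun r => (δ r : ℤ), sum_sub_distrib, sum_add_distrib] at h1
  linarith

namespace Nat.Partition

variable {n : ℕ} (d : ℕ) (hd : 0 < d) (lam : n.Partition)

/-- The contribution of a colouring with colours in `Fin (d * n) × Fin d` to the value of the
character of `boxPlus d lam` at a permutation with all cycle lengths divisible by `d`. -/
noncomputable def boxTerm {α : Type*} [Fintype α] (lam : n.Partition)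
    (F : α → Fin (d * n) × Fin d) : ℤ :=
  ∏ j, alternant (staircase (d * n)) fun a =>
    lam.youngDiagram.rowLen a + staircase (d * n) a - (content F (a, j) / d : ℕ)

theorem irreducibleCharacter_boxPlus {w : Perm (Fin (d ^ 2 * n))}
    (hw : ∀ p ∈ w.partition.parts, d ∣ p) :
    (lam.boxPlus d hd).irreducibleCharacter w =
      (∑ F : Fin (d ^ 2 * n) → Fin (d * n) × Fin d with ∀ i, F (w i) = F i,
        lam.boxTerm d F : ℤ) := by
  rw [irreducibleCharacter_eq_frobeniusCharacter _ (L := d * n * d) (le_of_eq (by ring)),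
    frobeniusCharacter, colorSum, Int.cast_sum]
  refine (sum_equiv ((Equiv.refl _).arrowCongr finProdFinEquiv) (fun F => ?_) fun F hF => ?_).symm
  · simp
  · have hc (x) : content (((Equiv.refl _).arrowCongr finProdFinEquiv) F) (finProdFinEquiv x) =
        content F x := by
      simp [content]
    rw [← alternant_comp_equiv finProdFinEquiv, boxTerm, ← alternant_staircase_mul]
    congr 2
    funext x
    obtain ⟨c, hx⟩ := Coloring.dvd_content hw ((mem_filter_univ F).1 hF) x
    rw [Function.comp_apply, hc, staircase_mul, finProdFinEquiv_apply_val,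
      rowLen_boxPlus d hd lam _ x.2.2, hx, Nat.mul_div_cancel_left _ hd]
    push_cast
    ring

variable {d hd lam}

theorem sum_content_div_of_boxTerm_ne_zero {α : Type*} [Fintype α] {F : α → Fin (d * n) × Fin d}
    (h : lam.boxTerm d F ≠ 0) (j : Fin d) : ∑ a, content F (a, j) / d = n := by
  have h1 := sum_eq_of_alternant_ne_zero (prod_ne_zero_iff.1 h j (mem_univ j))
  have hd : 0 < d := j.pos
  rw [← Nat.cast_sum, ← Nat.cast_sum, Nat.cast_inj] at h1
  rw [h1, lam.sum_rowLen (Nat.le_mul_of_pos_left n hd)]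

theorem boxTerm_perm {α : Type*} [Fintype α] (F₁ : α → Fin (d * n)) (F₂ : α → Fin d)
    (π : Perm (Fin d)) :
    lam.boxTerm d (fun i => (F₁ i, π (F₂ i))) = lam.boxTerm d fun i => (F₁ i, F₂ i) := by
  unfold boxTerm
  rw [← Equiv.prod_comp π]
  simp [content]

end Nat.Partition

theorem theorem2 (d : ℕ) (hd : 0 < d) (n : ℕ) (hn : 0 < n) (lam : n.Partition) :
    (∀ (μ : (d * n).Partition) (w : Equiv.Perm (Fin (d ^ 2 * n))),
      w.partition.parts = (μ.dilate d hd).parts →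
        ∃ k : ℤ, (lam.boxPlus d hd).irreducibleCharacter w = (d.factorial : ℂ) * (k : ℂ)) ∧
    (¬ d ∣ n → ∀ (ν : n.Partition) (w : Equiv.Perm (Fin (d ^ 2 * n))),
      w.partition.parts = (ν.dilate (d ^ 2) (pow_pos hd 2)).parts →
        (lam.boxPlus d hd).irreducibleCharacter w = 0) := by
  have hdil {m q : ℕ} (hq : 0 < q) (μ : m.Partition) : ∀ p ∈ (μ.dilate q hq).parts, q ∣ p := by
    intro p hp
    obtain ⟨i, -, rfl⟩ := Multiset.mem_map.1 hp
    exact dvd_mul_right q i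
  constructor
  · intro μ w hw
    have hdvd : ∀ p ∈ w.partition.parts, d ∣ p := hw ▸ hdil hd μ
    rw [Nat.Partition.irreducibleCharacter_boxPlus d hd lam hdvd]
    suffices h : (d.factorial : ℤ) ∣ ∑ F : Fin (d ^ 2 * n) → Fin (d * n) × Fin d with
        ∀ i, F (w i) = F i, lam.boxTerm d F by
      obtain ⟨k, hk⟩ := h
      exact ⟨k, by rw [hk]; push_cast; rfl⟩
    rw [sum_filter, ← Equiv.sum_comp (Equiv.arrowProdEquivProdArrow _ _ _).symm,
      Fintype.sum_prod_type]
    refine dvd_sum fun F₁ _ => factorial_dvd_sum_of_surjective (fun π F₂ => ?_) fun F₂ h j => ?_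
    · have h1 := Nat.Partition.boxTerm_perm (lam := lam) F₁ F₂ π
      simp only [Equiv.arrowProdEquivProdArrow_symm_apply, Prod.ext_iff, Function.comp_apply,
        EmbeddingLike.apply_eq_iff_eq]
      exact if_congr Iff.rfl h1 rfl
    · have h1 := Nat.Partition.sum_content_div_of_boxTerm_ne_zero (ite_ne_right_iff.1 h).2 j
      by_contra! hj
      have h0 (a) : content ((Equiv.arrowProdEquivProdArrow _ _ _).symm (F₁, F₂)) (a, j) = 0 := by
        rw [content, card_eq_zero, filter_eq_empty_iff]
        intro i _ hi
        exact hj i (congrArg Prod.snd hi)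
      simp only [h0, Nat.zero_div, sum_const_zero] at h1
      omega
  · intro hdn ν w hw
    have hdvd : ∀ p ∈ w.partition.parts, d ^ 2 ∣ p := hw ▸ hdil (pow_pos hd 2) ν
    rw [Nat.Partition.irreducibleCharacter_boxPlus d hd lam
      fun p hp => (Dvd.intro_left _ (pow_two d).symm).trans (hdvd p hp), sum_eq_zero, Int.cast_zero]
    intro F hF
    by_contra h
    refine hdn ?_
    rw [← Nat.Partition.sum_content_div_of_boxTerm_ne_zero h ⟨0, hd⟩]
    refine dvd_sum fun a _ => ?_
    obtain ⟨c, hc⟩ := Coloring.dvd_content hdvd ((mem_filter_univ F).1 hF) (a, ⟨0, hd⟩)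
    rw [hc, pow_two, mul_assoc, Nat.mul_div_cancel_left _ hd]
    exact dvd_mul_right d c
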